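/- **Setting.** Let $\mathbb X\subseteq\mathbb R^d$ be closed and convex, let $\xi$ be a random element with law $\Xi$, and let $f(\cdot,\xi):\mathbb X\to\mathbb R$ and $r:\mathbb X\to\mathbb R$ be lower semicontinuous, with $f$ jointly measurable and $f(x,\cdot)$ integrable for every $x\in\mathbb X$. Consider $$\min_{x\in\mathbb X}\ \varphi(x)=f(x)+r(x),\qquad f(x)=\mathbb E_{\xi\sim\Xi}[f(x,\xi)],$$ and assume that a minimizer exists; $\varphi^*$ is the minimum. A function $\psi:\mathbb X\to\mathbb R$ is $\tau$-weakly convex if $\theta=\psi+\frac\tau2\|\cdot\|^2$ is convex on $\mathbb X$; then $\partial\psi(x)=\partial\theta(x)-\tau x$, where $\partial\theta(x)=\{v:\theta(y)\ge\theta(x)+\langle v,y-x\rangle\ \forall y\in\mathbb X\}$. Suppose that $r$ is $\eta$-weakly convex with $\eta\ge0$, and $f(\cdot,\xi)$ is $\rho(\xi)$-weakly convex with $\rho(\xi)\ge0$ and $\mathbb E[\rho(\xi)]\le\rho<\infty$. Let $\lambda>0$ satisfy $\lambda(\rho+2\eta)<1$ and let $$\varphi_\lambda(x)=\min_{y\in\mathbb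 X}\Big\{\varphi(y)+\tfrac1{2\lambda}\|y-x\|^2\Big\},\quad x\in\mathbb R^d,$$ be the Moreau envelope. A point $x\in\mathbb X$ is critical if $0\in\partial\varphi(x)+\mathcal N_{\mathbb X}(x)$, where $\mathcal N_{\mathbb X}(x)$ is the normal cone; $\varphi$ is level bounded if $\{x\in\mathbb X:\varphi(x)\le c\}$ is bounded for every $c\in\mathbb R$. **Sto-SubGrad.** For each $k$ let $g_k(x,\xi)\in\partial f(x,\xi)$ $(x\in\mathbb X)$ be the subgradients used in iteration $k$, measurable in $(x,\xi)$ (for instance the same $g$ for all $k$). Starting from a deterministic $x^0\in\mathbb X$, in iteration $k$ draw $\xi_k\sim\Xi$ independently of the past $\mathcal F_k$ and let $x^{k+1}$ be a ($\mathcal F_{k+1}$-measurable) minimizer over $\mathbb X$ of $$y\mapsto\langle g_k(x^k,\xi_k),y\rangle+r(y)+\tfrac1{2\alpha_k}\|y-x^k\|^2 .$$ **Bounds.** Suppose that one of the following holds (uniformly in $k$): * (B$'_{D\text{-}D}$) there are $L_f\ge0$ and $L_f(\xi)$ with $\|g_k(x,\xi)\|\le L_f(\xi)$ for all $x\in\mathbb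 X$ and all $\xi$, and $\mathbb E[L_f(\xi)^2]\le L_f^2$; * (B$'_3$) there are $c_3,c_4\ge0$ such that for each $x\in\mathbb X$ some $h(x)\in\partial r(x)$ satisfies $\mathbb E\|g_k(x,\xi)+h(x)\|^2\le c_3[\varphi_\lambda(x)-\varphi^*]+c_4$; * (B$'_4$) there are $c_5,c_6\ge0$ such that for each $x\in\mathbb X$ some $h(x)\in\partial r(x)$ satisfies $\mathbb E\|g_k(x,\xi)+h(x)\|^2\le c_5\|\nabla\varphi_\lambda(x)\|^2+c_6$. A sequence $\{\alpha_k\}$ is a $\sigma$-sequence if $\alpha_k>0$, $\sum_k\alpha_k=\infty$ and $\sum_k\alpha_k^2<\infty$. Call a stepsize $a$ admissible if $a<\frac1{2(\rho+2\eta+1/\lambda)}$ in case (B$'_{D\text{-}D}$), and if $6\eta a<1$ in the cases (B$'_3$), (B$'_4$). **Theorem (Convergence of Sto-SubGrad).** The function $\varphi_\lambda$ is differentiable on $\mathbb R^d$, and: (i) If $\varphi$ is level bounded and $\{\alpha_k\}$ is a $\sigma$-sequence, then almost surely $\lim_{k\to\infty}\|\nabla\varphi_\lambda(x^k)\|=0$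 and every accumulation point of $\{x^k\}$ is a critical point of the problem. (ii) There are constants $\gamma_4,\gamma_5>0$, independent of $x^0$, of the stepsizes and of the run, such that for every $\sigma$-sequence of admissible stepsizes with $\sum_k\alpha_k^2\le\bar{\mathfrak a}$, every $$\gamma_6\ge\gamma_5+\gamma_4\big[\varphi_\lambda(x^0)-\varphi^*+\gamma_5\bar{\mathfrak a}\big]e^{1+\gamma_4\bar{\mathfrak a}}$$ and every $T\ge0$, the expectations below are finite and $$\min_{0\le k\le T}\mathbb E\big[\|\nabla\varphi_\lambda(x^k)\|^2\big]\le\frac{2}{1-\lambda(\rho+2\eta)}\cdot\frac{\varphi_\lambda(x^0)-\varphi^*+\gamma_6\sum_{k=0}^T\alpha_k^2}{\sum_{k=0}^T\alpha_k}.$$ Moreover, for every $x^0\in\mathbb X$ and $\Delta_4>0$ there is $R_3\ge0$ such that for every $T\ge0$ for which the constant stepsize $\alpha_k=\Delta_4/\sqrt{T+1}$, $k=0,\dots,T$, is admissible, the iterates generated with this stepsize satisfy $$\min_{0\le k\le T}\mathbb E\big[\|\nabla\varphi_\lambda(x^k)\|^2\big]\le\frac{R_3}{\sqrt{T+1}}.$$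 -/

import Mathlib

open MeasureTheory ProbabilityTheory Filter Topology
open scoped Gradient RealInnerProductSpace

/-- The Euclidean space `ℝ^d`. -/
abbrev Vec (d : ℕ) : Type := EuclideanSpace ℝ (Fin d)

/-- `φ : X → ℝ` is `ρ`-weakly convex: `φ + (ρ/2)‖·‖²` is convex on `X`. -/
def WeaklyConvexOn {d : ℕ} (X : Set (Vec d)) (ρ : ℝ) (φ : Vec d → ℝ) : Prop :=
  ConvexOn ℝ X (fun x => φ x + ρ / 2 * ‖x‖ ^ 2)

/-- The convex subdifferential of `θ : X → ℝ` at `x`. -/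
def convexSubdiff {d : ℕ} (X : Set (Vec d)) (θ : Vec d → ℝ) (x : Vec d) : Set (Vec d) :=
  {v | ∀ y ∈ X, θ x + ⟪v, y - x⟫ ≤ θ y}

/-- The subdifferential of a `ρ`-weakly convex `φ : X → ℝ` at `x`:
`∂φ(x) = ∂θ(x) - ρ x` with `θ = φ + (ρ/2)‖·‖²`. -/
def weakSubdiff {d : ℕ} (X : Set (Vec d)) (ρ : ℝ) (φ : Vec d → ℝ) (x : Vec d) : Set (Vec d) :=
  {v | ∃ w ∈ convexSubdiff X (fun y => φ y + ρ / 2 * ‖y‖ ^ 2) x, v = w - ρ • x}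

/-- The normal cone of `X` at `x`. -/
def normalConeAt {d : ℕ} (X : Set (Vec d)) (x : Vec d) : Set (Vec d) :=
  {n | ∀ y ∈ X, ⟪n, y - x⟫ ≤ 0}

/-- `x` is a critical point of `min_X φ`, with `φ` `ρ`-weakly convex: `0 ∈ ∂φ(x) + N_X(x)`. -/
def IsCriticalOn {d : ℕ} (X : Set (Vec d)) (ρ : ℝ) (φ : Vec d → ℝ) (x : Vec d) : Prop :=
  x ∈ X ∧ ∃ v ∈ weakSubdiff X ρ φ x, ∃ n ∈ normalConeAt X x, v + n = 0

/-- All sublevel sets of `φ` on `X` are bounded. -/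
def LevelBoundedOn {d : ℕ} (X : Set (Vec d)) (φ : Vec d → ℝ) : Prop :=
  ∀ c : ℝ, Bornology.IsBounded {x ∈ X | φ x ≤ c}

/-- The Moreau envelope `φ_λ(x) = inf_{y ∈ X} (φ(y) + ‖y - x‖² / (2λ))`. -/
noncomputable def moreauEnv {d : ℕ} (X : Set (Vec d)) (φ : Vec d → ℝ) (lam : ℝ)
    (x : Vec d) : ℝ :=
  sInf ((fun y => φ y + 1 / (2 * lam) * ‖y - x‖ ^ 2) '' X)

/-- The objective `φ(x) = E_{ξ ∼ P}[f(x, ξ)] + r(x)`. -/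
noncomputable def expectedObjective {d : ℕ} {S : Type*} [MeasurableSpace S] (P : Measure S)
    (f : Vec d → S → ℝ) (r : Vec d → ℝ) (x : Vec d) : ℝ :=
  (∫ s, f x s ∂P) + r x

/-- Expected Lipschitz bound `(B'_{D-D})` on the stochastic subgradients `g k x ξ`:
`‖g k x ξ‖ ≤ L(ξ)` on `X`, with `E[L(ξ)²] ≤ Lf²`. -/
def BoundDD {d : ℕ} {S : Type*} [MeasurableSpace S] (P : Measure S) (X : Set (Vec d))
    (g : ℕ → Vec d → S → Vec d) : Prop :=
  ∃ (Lf : ℝ) (L : S → ℝ), 0 ≤ Lf ∧ MemLp L 2 P ∧ (∫ s, L s ^ 2 ∂P) ≤ Lf ^ 2 ∧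
    ∀ k, ∀ x ∈ X, ∀ s, ‖g k x s‖ ≤ L s

/-- `(B'_3)`: `E‖g(x,ξ) + h(x)‖² ≤ c₃ (φ_λ(x) - φ*) + c₄` on `X`, with `h(x) ∈ ∂r(x)`. -/
def BoundThree {d : ℕ} {S : Type*} [MeasurableSpace S] (P : Measure S) (X : Set (Vec d))
    (η : ℝ) (r φ : Vec d → ℝ) (φstar lam : ℝ) (g : ℕ → Vec d → S → Vec d) : Prop :=
  ∃ c₃ c₄ : ℝ, 0 ≤ c₃ ∧ 0 ≤ c₄ ∧ ∀ k, ∀ x ∈ X, ∃ h ∈ weakSubdiff X η r x,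
    Integrable (fun s => ‖g k x s + h‖ ^ 2) P ∧
    (∫ s, ‖g k x s + h‖ ^ 2 ∂P) ≤ c₃ * (moreauEnv X φ lam x - φstar) + c₄

/-- `(B'_4)`: `E‖g(x,ξ) + h(x)‖² ≤ c₅ ‖∇φ_λ(x)‖² + c₆` on `X`, with `h(x) ∈ ∂r(x)`. -/
def BoundFour {d : ℕ} {S : Type*} [MeasurableSpace S] (P : Measure S) (X : Set (Vec d))
    (η : ℝ) (r φ : Vec d → ℝ) (lam : ℝ) (g : ℕ → Vec d → S → Vec d) : Prop :=
  ∃ c₅ c₆ : ℝ, 0 ≤ c₅ ∧ 0 ≤ c₆ ∧ ∀ k, ∀ x ∈ X, ∃ h ∈ weakSubdiff X η r x,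
    Integrable (fun s => ‖g k x s + h‖ ^ 2) P ∧
    (∫ s, ‖g k x s + h‖ ^ 2 ∂P) ≤ c₅ * ‖∇ (moreauEnv X φ lam) x‖ ^ 2 + c₆

/-- `σ`-sequence of stepsizes. -/
structure IsSigmaSequence (α : ℕ → ℝ) : Prop where
  pos : ∀ k, 0 < α k
  not_summable : ¬ Summable α
  summable_sq : Summable (fun k => α k ^ 2)

/-- `x` is generated by `N ≤ ∞` iterations of Sto-SubGrad started at `x0` with stepsizes `α`:
in iteration `k` a fresh sample `ξ k` of law `P`, independent of the past `ℱ k`, is drawn and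
`x (k+1)` is a minimizer over `X` of
`y ↦ ⟨g k (x k) (ξ k), y⟩ + r y + ‖y - x k‖² / (2 α k)`. -/
structure IsStoSubGradRun {d : ℕ} {S : Type*} [MeasurableSpace S] {Ω : Type*}
    [mΩ : MeasurableSpace Ω] (μ : Measure Ω) (P : Measure S) (X : Set (Vec d))
    (r : Vec d → ℝ) (g : ℕ → Vec d → S → Vec d) (α : ℕ → ℝ) (x0 : Vec d) (N : ℕ∞)
    (ℱ : Filtration ℕ mΩ) (ξ : ℕ → Ω → S) (x : ℕ → Ω → Vec d) : Prop where
  init : ∀ ω, x 0 ω = x0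
  iterate_measurable : ∀ k : ℕ, (k : ℕ∞) ≤ N → Measurable[ℱ k] (x k)
  sample_measurable : ∀ k : ℕ, (k : ℕ∞) < N → Measurable[ℱ (k + 1)] (ξ k)
  sample_law : ∀ k : ℕ, (k : ℕ∞) < N → μ.map (ξ k) = P
  sample_indep : ∀ k : ℕ, (k : ℕ∞) < N →
    Indep (MeasurableSpace.comap (ξ k) inferInstance) (ℱ k) μ
  step : ∀ k : ℕ, (k : ℕ∞) < N → ∀ ω, x (k + 1) ω ∈ X ∧
    IsMinOn (fun y => ⟪g k (x k ω) (ξ k ω), y⟫ + r y + 1 / (2 * α k) * ‖y - x k ω‖ ^ 2)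
      X (x (k + 1) ω)

/-- Upper limits on a stepsize `a`: `a < 1 / (2(ρ + 2η + 1/λ))` under `(B'_{D-D})`, and
`a < 1 / (6η)` (no restriction if `η = 0`) under `(B'_3)` or `(B'_4)`. -/
def AdmissibleStep {d : ℕ} {S : Type*} [MeasurableSpace S] (P : Measure S) (X : Set (Vec d))
    (ρ η : ℝ) (r φ : Vec d → ℝ) (φstar lam : ℝ) (g : ℕ → Vec d → S → Vec d)
    (a : ℝ) : Prop :=
  (BoundDD P X g ∧ a < 1 / (2 * (ρ + 2 * η + 1 / lam))) ∨
  ((BoundThree P X η r φ φstar lam g ∨ BoundFour P X η r φ lam g) ∧ 6 * η * a < 1)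

/-!
The gap `V(x) = φ_λ(x) - φ*` of the Moreau envelope is a Lyapunov function of the method, and `x̂
= prox(x)`, the proximal point of `x` for `φ`, is the point to compare with.

* *The envelope.* On `X`, `F = E[f(·, ξ)]` has the mean of `g k x` as a `ρ`-weak subgradient at
  every `x`; this alone makes `F` lower semicontinuous and weakly convex. So the objective in the
  definition of `φ_λ` is strongly convex, `x̂` exists and depends on `x` in a Lipschitz way, and
  `∇φ_λ(x) = (x - x̂) / λ` (`ProxRegular.hasGradientAt`). The same theory applied to `r` writes
  the iterate `x^{k+1}` as a continuous function of `x^k - α_k g_k`, hence as a measurable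
  function of `x^k` and of the sample.

* *One step* (`StoProblem.descent`). The three-point inequality of the proximal step at `x̂`,
  averaged over the sample, gives `E[V(x⁺) + 1] + c a ‖∇φ_λ(x)‖² ≤ (1 + C a²) (V(x) + 1)`, with `c
  = (1 - λ(ρ + 2η)) / 2`. Under `(B'_3)` the value `r(x⁺)` is bounded by a subgradient of `r` at
  `x`; under `(B'_{D-D})` it is bounded by the growth of `φ + ‖· - x‖² / (2λ)` around its
  minimizer `x̂`. `(B'_4)` reduces to `(B'_3)` by `‖∇φ_λ‖² ≤ (2/λ) V`.

* *Complexity* (`StoProblem.min_expected_gradient_le`). The fresh sample is independent of the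
  past and can be integrated out first; a discrete Gronwall inequality bounds `E[V(x^k)]`, and the
  one-step inequalities are then summed.

* *Almost sure convergence* (`StoProblem.ae_tendsto_gradient`). Stopping the run when `V` exceeds
  `M`, the same inequalities bound both `M` times the probability of stopping and the localized
  sum of `α_k ‖∇φ_λ(x^k)‖²` independently of `M`. So almost every run stays in a level set, which
  is bounded, and `∑ α_k ‖∇φ_λ(x^k)‖² < ∞` there. It remains to exclude oscillation. While `‖x^k -
  x̂^k‖ ≥ ε`, the squared distance of the iterates to the anchor `x̂^m` of an earlier time grows
  by summable amounts; taking for `m` the last visit to `{‖x - x̂‖ < ε}`, the iterates stay near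
  `x̂^m`, and hence near `x^m`, until the next visit (`tendsto_norm_sub_zero_of_anchored`). The
  anchor is a proximal point because under `(B'_{D-D})` the lengths of the steps themselves need
  not be of order `α_k`, as `r` may have unbounded slope.
-/

/-! ### Strongly convex functions and the proximal map -/

theorem norm_sq_add_smul_sub {d : ℕ} (x y : Vec d) (t : ℝ) :
    ‖x + t • (y - x)‖ ^ 2 = (1 - t) * ‖x‖ ^ 2 + t * ‖y‖ ^ 2 - t * (1 - t) * ‖y - x‖ ^ 2 := by
  rw [norm_add_sq_real, norm_smul, norm_sub_sq_real, inner_smul_right, inner_sub_right,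
    real_inner_self_eq_norm_sq, mul_pow, norm_sub_sq_real, Real.norm_eq_abs, sq_abs,
    real_inner_comm y x]
  ring

/-- The convexity inequality of `q`, with the quadratic gain, if `q - (m/2)‖·‖²` is convex. -/
theorem strong_convex_ineq {d : ℕ} {X : Set (Vec d)} {q : Vec d → ℝ} {m : ℝ}
    (hq : ConvexOn ℝ X (fun y => q y - m / 2 * ‖y‖ ^ 2)) {x y : Vec d} (hx : x ∈ X) (hy : y ∈ X)
    {t : ℝ} (ht0 : 0 ≤ t) (ht1 : t ≤ 1) :
    x + t • (y - x) ∈ X ∧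
      q (x + t • (y - x)) ≤ (1 - t) * q x + t * q y - m / 2 * (t * (1 - t)) * ‖y - x‖ ^ 2 := by
  have e : (1 - t) • x + t • y = x + t • (y - x) := by module
  have h := hq.2 hx hy (sub_nonneg.2 ht1) ht0 (by ring)
  have hm := hq.1 hx hy (sub_nonneg.2 ht1) ht0 (by ring)
  rw [e] at h hm
  refine ⟨hm, ?_⟩
  have h2 := norm_sq_add_smul_sub x y t
  simp only [smul_eq_mul] at h
  rw [h2] at h
  linarith

/-- Quadratic growth at a minimizer; the modulus `m` may have any sign. -/
theorem IsMinOn.quadratic_growth {d : ℕ} {X : Set (Vec d)} {q : Vec d → ℝ} {m : ℝ}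
    (hq : ConvexOn ℝ X (fun y => q y - m / 2 * ‖y‖ ^ 2)) {x : Vec d} (hx : x ∈ X)
    (hmin : IsMinOn q X x) {y : Vec d} (hy : y ∈ X) :
    q x + m / 2 * ‖y - x‖ ^ 2 ≤ q y := by
  have key : ∀ n : ℕ, q x + m / 2 * (1 - 1 / ((n : ℝ) + 1)) * ‖y - x‖ ^ 2 ≤ q y := by
    intro n
    have hn : (0 : ℝ) < 1 / ((n : ℝ) + 1) := by positivity
    have hn1 : 1 / ((n : ℝ) + 1) ≤ 1 := by
      rw [div_le_one (by positivity)]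
      linarith [(Nat.cast_nonneg n : (0 : ℝ) ≤ n)]
    obtain ⟨hm, h⟩ := strong_convex_ineq hq hx hy hn.le hn1
    have h3 : q x ≤ _ := hmin hm
    have h2 := h3.trans h
    set t := 1 / ((n : ℝ) + 1)
    have h4 : t * (q x + m / 2 * (1 - t) * ‖y - x‖ ^ 2) ≤ t * q y := by linarith
    exact le_of_mul_le_mul_left h4 hn
  have lim : Tendsto (fun n : ℕ => q x + m / 2 * (1 - 1 / ((n : ℝ) + 1)) * ‖y - x‖ ^ 2) atTop
      (𝓝 (q x + m / 2 * (1 - 0) * ‖y - x‖ ^ 2)) :=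
    (((tendsto_const_nhds.sub tendsto_one_div_add_atTop_nhds_zero_nat).const_mul _).mul_const
      _).const_add _
  have := le_of_tendsto' lim key
  simpa using this

/-- A lower semicontinuous strongly convex function on a nonempty closed convex set attains its
minimum. -/
theorem exists_isMinOn_of_strongly_convex {d : ℕ} {X : Set (Vec d)} (hX : IsClosed X)
    (hne : X.Nonempty) {q : Vec d → ℝ} (hlsc : LowerSemicontinuousOn q X) {m : ℝ} (hm : 0 < m)
    (hq : ConvexOn ℝ X (fun y => q y - m / 2 * ‖y‖ ^ 2)) : ∃ x ∈ X, IsMinOn q X x := by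
  obtain ⟨x₁, hx₁⟩ := hne
  have attain : ∀ R : ℝ, 0 ≤ R → ∃ z ∈ X ∩ Metric.closedBall x₁ R,
      IsMinOn q (X ∩ Metric.closedBall x₁ R) z := by
    intro R hR
    refine LowerSemicontinuousOn.exists_isMinOn (s := X ∩ Metric.closedBall x₁ R)
      ⟨x₁, hx₁, by simpa using hR⟩ ?_ (hlsc.mono Set.inter_subset_left)
    exact (isCompact_closedBall x₁ R).inter_left hX
  obtain ⟨z₁, -, hz₁⟩ := attain 1 zero_le_one
  set R : ℝ := 1 + 2 * (q x₁ - q z₁) / m with hR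
  have hx₁z : q z₁ ≤ q x₁ := hz₁ ⟨hx₁, by simp⟩
  have hR1 : 1 ≤ R := by
    have : 0 ≤ 2 * (q x₁ - q z₁) / m := div_nonneg (by linarith) hm.le
    linarith
  obtain ⟨z, ⟨hzX, -⟩, hz⟩ := attain R (by linarith)
  refine ⟨z, hzX, fun y hy => ?_⟩
  by_cases hyR : ‖y - x₁‖ ≤ R
  · exact hz ⟨hy, by simpa [dist_eq_norm] using hyR⟩
  push Not at hyR
  -- Outside the ball, scale `y` back into the unit ball around `x₁`.
  have hqx : q z ≤ q x₁ := hz ⟨hx₁, by simpa using zero_le_one.trans hR1⟩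
  refine hqx.trans ?_
  by_contra! hlt
  have htpos : 0 < ‖y - x₁‖ := by linarith
  have ht1 : 1 / ‖y - x₁‖ ≤ 1 := by rw [div_le_one htpos]; linarith
  obtain ⟨hmem, h⟩ := strong_convex_ineq hq hx₁ hy (one_div_pos.2 htpos).le ht1
  have h1 : q z₁ ≤ _ := (hz₁ ⟨hmem, by
    simp [norm_smul, htpos.ne']⟩).trans h
  set t := ‖y - x₁‖
  have h2 : m / 2 * (1 / t * (1 - 1 / t)) * t ^ 2 = m / 2 * (t - 1) := by
    field_simp
  have h3 : 1 / t * q y ≤ 1 / t * q x₁ := by gcongr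
  have h4 : m / 2 * (t - 1) ≤ q x₁ - q z₁ := by linarith
  have h5 : m / 2 * (R - 1) = q x₁ - q z₁ := by rw [hR]; field_simp; ring
  nlinarith

/-- The standing assumptions under which the proximal map of `ψ` on `X` is single-valued: `ψ` is
lower semicontinuous and `τ`-weakly convex on the closed convex set `X`, and `λτ < 1`. -/
structure ProxRegular {d : ℕ} (X : Set (Vec d)) (ψ : Vec d → ℝ) (τ lam : ℝ) : Prop where
  closed : IsClosed X
  nonempty : X.Nonempty
  lsc : LowerSemicontinuousOn ψ X
  wc : WeaklyConvexOn X τ ψ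
  lam_pos : 0 < lam
  lam_lt : lam * τ < 1

/-- The proximal point `argmin_{y ∈ X} (ψ(y) + ‖y - x‖² / (2λ))`, an arbitrary point if there is
no minimizer. -/
noncomputable def proxMap {d : ℕ} (X : Set (Vec d)) (ψ : Vec d → ℝ) (lam : ℝ) (x : Vec d) :
    Vec d :=
  Classical.epsilon fun z => z ∈ X ∧ IsMinOn (fun y => ψ y + 1 / (2 * lam) * ‖y - x‖ ^ 2) X z

/-- Adding a linear function and the proximal term to a `τ`-weakly convex function makes it
`(1/λ - τ)`-strongly convex. -/
theorem WeaklyConvexOn.prox_objective {d : ℕ} {X : Set (Vec d)} {ψ : Vec d → ℝ} {τ : ℝ}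
    (h : WeaklyConvexOn X τ ψ) (lam : ℝ) (v x : Vec d) :
    ConvexOn ℝ X (fun y => (⟪v, y⟫ + ψ y + 1 / (2 * lam) * ‖y - x‖ ^ 2)
      - (1 / lam - τ) / 2 * ‖y‖ ^ 2) := by
  have hl : ConvexOn ℝ X (fun y => ⟪v - (1 / lam) • x, y⟫ + 1 / (2 * lam) * ‖x‖ ^ 2) := by
    refine ⟨h.1, fun a _ b _ s t _ _ hst => le_of_eq ?_⟩
    simp only [inner_add_right, inner_smul_right, smul_eq_mul]
    linear_combination (-(1 / (2 * lam)) * ‖x‖ ^ 2) * hst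
  have := ConvexOn.add h hl
  refine this.congr fun y _ => ?_
  simp only [Pi.add_apply]
  rw [norm_sub_sq_real, inner_sub_left, inner_smul_left, real_inner_comm y x]
  simp only [conj_trivial]
  ring

namespace ProxRegular

variable {d : ℕ} {X : Set (Vec d)} {ψ : Vec d → ℝ} {τ lam : ℝ}

theorem modulus_pos (h : ProxRegular X ψ τ lam) : 0 < 1 / lam - τ := by
  have := h.lam_pos
  rw [sub_pos, lt_div_iff₀ this]
  linarith [h.lam_lt]

theorem convexOn (h : ProxRegular X ψ τ lam) (x : Vec d) :
    ConvexOn ℝ X (fun y => (ψ y + 1 / (2 * lam) * ‖y - x‖ ^ 2) - (1 / lam - τ) / 2 * ‖y‖ ^ 2) := by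
  simpa using h.wc.prox_objective lam 0 x

theorem prox_spec (h : ProxRegular X ψ τ lam) (x : Vec d) :
    proxMap X ψ lam x ∈ X ∧
      IsMinOn (fun y => ψ y + 1 / (2 * lam) * ‖y - x‖ ^ 2) X (proxMap X ψ lam x) := by
  have hc : Continuous fun y : Vec d => 1 / (2 * lam) * ‖y - x‖ ^ 2 := by fun_prop
  obtain ⟨z, hz⟩ := exists_isMinOn_of_strongly_convex h.closed h.nonempty
    (h.lsc.add (hc.lowerSemicontinuous.lowerSemicontinuousOn X)) h.modulus_pos (h.convexOn x)
  exact Classical.epsilon_spec (p := fun z => z ∈ X ∧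
    IsMinOn (fun y => ψ y + 1 / (2 * lam) * ‖y - x‖ ^ 2) X z) ⟨z, hz⟩

theorem growth (h : ProxRegular X ψ τ lam) (x : Vec d) {y : Vec d} (hy : y ∈ X) :
    ψ (proxMap X ψ lam x) + 1 / (2 * lam) * ‖proxMap X ψ lam x - x‖ ^ 2
      + (1 / lam - τ) / 2 * ‖y - proxMap X ψ lam x‖ ^ 2 ≤ ψ y + 1 / (2 * lam) * ‖y - x‖ ^ 2 :=
  (h.prox_spec x).2.quadratic_growth (h.convexOn x) (h.prox_spec x).1 hy

theorem eq_prox (h : ProxRegular X ψ τ lam) {x z : Vec d} (hz : z ∈ X)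
    (hmin : IsMinOn (fun y => ψ y + 1 / (2 * lam) * ‖y - x‖ ^ 2) X z) :
    z = proxMap X ψ lam x := by
  have h1 := h.growth x hz
  have h2 : ψ z + 1 / (2 * lam) * ‖z - x‖ ^ 2 ≤ _ := hmin (h.prox_spec x).1
  have h3 := h.modulus_pos
  have h4 : ‖z - proxMap X ψ lam x‖ ^ 2 ≤ 0 := by
    by_contra! h5
    have := mul_pos (half_pos h3) h5
    simp only at h2
    linarith
  exact sub_eq_zero.1 (norm_eq_zero.1 (pow_eq_zero_iff two_ne_zero |>.1
    (le_antisymm h4 (sq_nonneg _))))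

theorem moreauEnv_eq (h : ProxRegular X ψ τ lam) (x : Vec d) :
    moreauEnv X ψ lam x =
      ψ (proxMap X ψ lam x) + 1 / (2 * lam) * ‖proxMap X ψ lam x - x‖ ^ 2 := by
  refine IsLeast.csInf_eq ⟨⟨_, (h.prox_spec x).1, rfl⟩, ?_⟩
  rintro _ ⟨y, hy, rfl⟩
  exact (h.prox_spec x).2 hy

theorem moreauEnv_le (h : ProxRegular X ψ τ lam) (x : Vec d) {y : Vec d} (hy : y ∈ X) :
    moreauEnv X ψ lam x ≤ ψ y + 1 / (2 * lam) * ‖y - x‖ ^ 2 := by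
  rw [h.moreauEnv_eq]
  exact (h.prox_spec x).2 hy

theorem prox_lipschitz (h : ProxRegular X ψ τ lam) (x y : Vec d) :
    ‖proxMap X ψ lam x - proxMap X ψ lam y‖ ≤ 1 / (1 - lam * τ) * ‖x - y‖ := by
  have h1 := h.growth x (h.prox_spec y).1
  have h2 := h.growth y (h.prox_spec x).1
  have hl := h.lam_pos
  set p := proxMap X ψ lam x
  set q := proxMap X ψ lam y
  have e : ‖q - x‖ ^ 2 + ‖p - y‖ ^ 2 - ‖p - x‖ ^ 2 - ‖q - y‖ ^ 2 = 2 * ⟪p - q, x - y⟫ := by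
    simp only [norm_sub_sq_real, inner_sub_left, inner_sub_right]
    ring
  have e2 : ‖q - p‖ = ‖p - q‖ := norm_sub_rev _ _
  rw [e2] at h1
  have h3 : (1 / lam - τ) * ‖p - q‖ ^ 2 ≤ 1 / lam * ⟪p - q, x - y⟫ := by
    have e3 : 1 / lam * ⟪p - q, x - y⟫ = 1 / (2 * lam) * (2 * ⟪p - q, x - y⟫) := by
      field_simp
    rw [e3, ← e]
    linarith
  have h4 : ⟪p - q, x - y⟫ ≤ ‖p - q‖ * ‖x - y‖ := real_inner_le_norm _ _
  have h5 : (1 - lam * τ) * ‖p - q‖ ^ 2 ≤ ‖p - q‖ * ‖x - y‖ := by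
    have : lam * ((1 / lam - τ) * ‖p - q‖ ^ 2) ≤ lam * (1 / lam * ⟪p - q, x - y⟫) := by gcongr
    have e5 : lam * (1 / lam * ⟪p - q, x - y⟫) = ⟪p - q, x - y⟫ := by field_simp
    have e6 : lam * ((1 / lam - τ) * ‖p - q‖ ^ 2) = (1 - lam * τ) * ‖p - q‖ ^ 2 := by field_simp
    linarith
  have hpos : 0 < 1 - lam * τ := by linarith [h.lam_lt]
  rw [one_div, ← div_eq_inv_mul, le_div_iff₀ hpos]
  rcases (norm_nonneg (p - q)).eq_or_lt with h0 | h0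
  · rw [← h0]; simp
  · refine le_of_mul_le_mul_left ?_ h0
    linarith

theorem continuous_prox (h : ProxRegular X ψ τ lam) : Continuous (proxMap X ψ lam) := by
  have hpos : 0 < 1 / (1 - lam * τ) := one_div_pos.2 (by linarith [h.lam_lt])
  refine (LipschitzWith.of_dist_le_mul (K := ⟨_, hpos.le⟩) fun x y => ?_).continuous
  rw [dist_eq_norm, dist_eq_norm]
  exact h.prox_lipschitz x y

/-- The Moreau envelope is differentiable, with gradient `(x - prox x) / λ`: testing the envelope
at `y` with the proximal point of `x`, and conversely, traps the first-order remainder between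
multiples of `‖y - x‖²`. -/
theorem hasGradientAt (h : ProxRegular X ψ τ lam) (x : Vec d) :
    HasGradientAt (moreauEnv X ψ lam) ((1 / lam) • (x - proxMap X ψ lam x)) x := by
  have hl := h.lam_pos
  have hpos : 0 < 1 / (1 - lam * τ) := one_div_pos.2 (by linarith [h.lam_lt])
  have upper : ∀ x y, moreauEnv X ψ lam y - moreauEnv X ψ lam x
      - ⟪(1 / lam) • (x - proxMap X ψ lam x), y - x⟫ ≤ 1 / (2 * lam) * ‖y - x‖ ^ 2 := by
    intro x y
    have h1 := h.moreauEnv_le y (h.prox_spec x).1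
    rw [h.moreauEnv_eq x]
    set p := proxMap X ψ lam x
    have e : ‖p - y‖ ^ 2 = ‖p - x‖ ^ 2 + 2 * ⟪x - p, y - x⟫ + ‖y - x‖ ^ 2 := by
      simp only [norm_sub_sq_real, inner_sub_left, inner_sub_right, real_inner_self_eq_norm_sq,
        real_inner_comm x y]
      ring
    rw [e] at h1
    rw [inner_smul_left]
    simp only [conj_trivial]
    have e3 : 1 / (2 * lam) * (2 * ⟪x - p, y - x⟫) = 1 / lam * ⟪x - p, y - x⟫ := by field_simp
    linarith
  set K := 1 / (1 - lam * τ)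
  have bound : ∀ y, |moreauEnv X ψ lam y - moreauEnv X ψ lam x
      - ⟪(1 / lam) • (x - proxMap X ψ lam x), y - x⟫| ≤ (1 / lam * (2 + K)) * ‖y - x‖ ^ 2 := by
    intro y
    have h1 := upper x y
    have h2 := upper y x
    have h3 : ⟪(1 / lam) • (y - proxMap X ψ lam y), x - y⟫
        = - ⟪(1 / lam) • (x - proxMap X ψ lam x), y - x⟫ - 1 / lam * ‖y - x‖ ^ 2
          + 1 / lam * ⟪proxMap X ψ lam y - proxMap X ψ lam x, y - x⟫ := by
      rw [inner_smul_left, inner_smul_left, ← real_inner_self_eq_norm_sq]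
      simp only [inner_sub_left, inner_sub_right, conj_trivial]
      ring
    have h4 : ⟪proxMap X ψ lam y - proxMap X ψ lam x, y - x⟫ ≤ K * ‖y - x‖ ^ 2 := by
      refine (real_inner_le_norm _ _).trans ?_
      have := mul_le_mul_of_nonneg_right (h.prox_lipschitz y x) (norm_nonneg (y - x))
      linarith
    have h5 := real_inner_le_norm (proxMap X ψ lam x - proxMap X ψ lam y) (y - x)
    have h6 : -(K * ‖y - x‖ ^ 2) ≤ ⟪proxMap X ψ lam y - proxMap X ψ lam x, y - x⟫ := by
      rw [← neg_sub (proxMap X ψ lam x) (proxMap X ψ lam y), inner_neg_left]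
      have := mul_le_mul_of_nonneg_right (h.prox_lipschitz x y) (norm_nonneg (y - x))
      rw [norm_sub_rev x y] at this
      linarith
    have hs : 0 ≤ 1 / lam * ‖y - x‖ ^ 2 := by positivity
    have hsK : 0 ≤ 1 / lam * (K * ‖y - x‖ ^ 2) := by positivity
    have e1 : 1 / (2 * lam) * ‖y - x‖ ^ 2 = (1 / lam * ‖y - x‖ ^ 2) / 2 := by field_simp
    have h4' := mul_le_mul_of_nonneg_left h4 (one_div_pos.2 hl).le
    have h6' := mul_le_mul_of_nonneg_left h6 (one_div_pos.2 hl).le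
    rw [norm_sub_rev x y, h3] at h2
    rw [abs_le]
    constructor <;> nlinarith
  rw [hasGradientAt_iff_isLittleO]
  refine (Asymptotics.IsBigO.of_bound (1 / lam * (2 + K)) (Eventually.of_forall fun y => ?_)
    : _ =O[𝓝 x] fun y => ‖y - x‖ ^ 2).trans_isLittleO ?_
  · rw [Real.norm_eq_abs, norm_pow, norm_norm]
    exact bound y
  · have : Tendsto (fun y => y - x) (𝓝 x) (𝓝 0) := by
      have : Tendsto (fun y : Vec d => y - x) (𝓝 x) (𝓝 (x - x)) := by
        exact (continuous_id.sub continuous_const).tendsto x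
      simpa using this
    exact (Asymptotics.isLittleO_norm_pow_id one_lt_two).comp_tendsto this

theorem gradient_eq (h : ProxRegular X ψ τ lam) (x : Vec d) :
    ∇ (moreauEnv X ψ lam) x = (1 / lam) • (x - proxMap X ψ lam x) :=
  (h.hasGradientAt x).gradient

theorem norm_gradient (h : ProxRegular X ψ τ lam) (x : Vec d) :
    ‖∇ (moreauEnv X ψ lam) x‖ = 1 / lam * ‖proxMap X ψ lam x - x‖ := by
  rw [h.gradient_eq, norm_smul, Real.norm_eq_abs, abs_of_pos (one_div_pos.2 h.lam_pos),
    norm_sub_rev]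

theorem differentiable_moreauEnv (h : ProxRegular X ψ τ lam) :
    Differentiable ℝ (moreauEnv X ψ lam) :=
  fun x => (h.hasGradientAt x).hasFDerivAt.differentiableAt

end ProxRegular

/-! ### Subgradients of weakly convex functions -/

/-- Weak subgradients are the slopes of quadratic minorants that touch at `x`. -/
theorem mem_weakSubdiff_iff {d : ℕ} {X : Set (Vec d)} {ρ : ℝ} {φ : Vec d → ℝ} {x v : Vec d} :
    v ∈ weakSubdiff X ρ φ x ↔ ∀ y ∈ X, φ x + ⟪v, y - x⟫ - ρ / 2 * ‖y - x‖ ^ 2 ≤ φ y := by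
  have key : ∀ y, ρ / 2 * ‖x‖ ^ 2 + ⟪v + ρ • x, y - x⟫ - ρ / 2 * ‖y‖ ^ 2
      = ⟪v, y - x⟫ - ρ / 2 * ‖y - x‖ ^ 2 := by
    intro y
    rw [norm_sub_sq_real, inner_add_left, inner_smul_left, inner_sub_right x,
      real_inner_self_eq_norm_sq, real_inner_comm x y]
    simp only [conj_trivial]
    ring
  constructor
  · rintro ⟨w, hw, rfl⟩ y hy
    have h1 := hw y hy
    have h2 := key y
    simp only [sub_add_cancel] at h1 h2
    linarith
  · refine fun h => ⟨v + ρ • x, fun y hy => ?_, by simp⟩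
    have h1 := h y hy
    have h2 := key y
    simp only
    linarith

section QuadraticSupport

variable {d : ℕ} {X : Set (Vec d)} {ρ : ℝ} {F : Vec d → ℝ} {v : Vec d → Vec d}

theorem lowerSemicontinuousOn_of_quadratic_support
    (h : ∀ x ∈ X, ∀ y ∈ X, F x + ⟪v x, y - x⟫ - ρ / 2 * ‖y - x‖ ^ 2 ≤ F y) :
    LowerSemicontinuousOn F X := by
  intro x hx c hc
  have hcont : Continuous fun y => F x + ⟪v x, y - x⟫ - ρ / 2 * ‖y - x‖ ^ 2 := by fun_prop
  have h1 : ∀ᶠ y in 𝓝 x, c < F x + ⟪v x, y - x⟫ - ρ / 2 * ‖y - x‖ ^ 2 :=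
    (hcont.tendsto x).eventually_const_lt (by simpa using hc)
  filter_upwards [nhdsWithin_le_nhds h1, self_mem_nhdsWithin] with y hy hyX
  exact hy.trans_le (h x hx y hyX)

theorem weaklyConvexOn_of_quadratic_support (hX : Convex ℝ X)
    (h : ∀ x ∈ X, ∀ y ∈ X, F x + ⟪v x, y - x⟫ - ρ / 2 * ‖y - x‖ ^ 2 ≤ F y) :
    WeaklyConvexOn X ρ F := by
  refine ⟨hX, fun x hx y hy a b ha hb hab => ?_⟩
  have hz := hX hx hy ha hb hab
  obtain ⟨w, hw, -⟩ := mem_weakSubdiff_iff.2 (h _ hz)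
  have h1 := mul_le_mul_of_nonneg_left (hw x hx) ha
  have h2 := mul_le_mul_of_nonneg_left (hw y hy) hb
  have h3 : a * ⟪w, x - (a • x + b • y)⟫ + b * ⟪w, y - (a • x + b • y)⟫ = 0 := by
    simp only [inner_sub_right, inner_add_right, inner_smul_right]
    linear_combination (-(a * ⟪w, x⟫ + b * ⟪w, y⟫)) * hab
  simp only [smul_eq_mul]
  simp only at h1 h2
  set q := F (a • x + b • y) + ρ / 2 * ‖a • x + b • y‖ ^ 2
  have h4 : a * q + b * q = q := by rw [← add_mul, hab, one_mul]
  linarith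

end QuadraticSupport

/-! ### The composite problem and one step of the method -/

/-- The optimality gap `φ_λ(x) - φ*` of the Moreau envelope. -/
noncomputable def envGap {d : ℕ} (X : Set (Vec d)) (φ : Vec d → ℝ) (lam : ℝ) (xstar x : Vec d) :
    ℝ :=
  moreauEnv X φ lam x - φ xstar

/-- The properties of `φ = F + r` and of the stochastic subgradients that the convergence analysis
uses. About the expectation `F` it only needs that the mean of `g k x` is a `ρ`-weak subgradient of
`F` at every point `x` of `X`. -/
structure StoProblem {d : ℕ} {S : Type*} [MeasurableSpace S] (P : Measure S) (X : Set (Vec d))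
    (F r φ : Vec d → ℝ) (ρ η lam : ℝ) (xstar : Vec d) (g : ℕ → Vec d → S → Vec d) : Prop where
  eq_add : ∀ x, φ x = F x + r x
  closed : IsClosed X
  convex : Convex ℝ X
  r_lsc : LowerSemicontinuousOn r X
  r_wc : WeaklyConvexOn X η r
  eta_nonneg : 0 ≤ η
  rho_nonneg : 0 ≤ ρ
  lam_pos : 0 < lam
  lam_lt : lam * (ρ + 2 * η) < 1
  xstar_mem : xstar ∈ X
  isMinOn : IsMinOn φ X xstar
  g_meas : ∀ k, Measurable (Function.uncurry (g k))
  g_int : ∀ k, ∀ x ∈ X, Integrable (g k x) P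
  support : ∀ k, ∀ x ∈ X, ∀ y ∈ X, F x + ⟪∫ s, g k x s ∂P, y - x⟫ - ρ / 2 * ‖y - x‖ ^ 2 ≤ F y

/-- `z` is an outcome of the proximal step from `x` along `v` with stepsize `a`. -/
def IsProxStep {d : ℕ} (X : Set (Vec d)) (r : Vec d → ℝ) (a : ℝ) (v x z : Vec d) : Prop :=
  z ∈ X ∧ IsMinOn (fun y => ⟪v, y⟫ + r y + 1 / (2 * a) * ‖y - x‖ ^ 2) X z

theorem prox_objective_completion {d : ℕ} (r : Vec d → ℝ) {a : ℝ} (ha : 0 < a) (v x y : Vec d) :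
    r y + 1 / (2 * a) * ‖y - (x - a • v)‖ ^ 2 =
      (⟪v, y⟫ + r y + 1 / (2 * a) * ‖y - x‖ ^ 2) + (a / 2 * ‖v‖ ^ 2 - ⟪v, x⟫) := by
  have e : y - (x - a • v) = (y - x) + a • v := by module
  rw [e, norm_add_sq_real, inner_smul_right, norm_smul, mul_pow, Real.norm_eq_abs, sq_abs,
    real_inner_comm, inner_sub_right]
  field_simp
  ring

/-- The proximal step is the proximal map of `r` after a subgradient step. -/
theorem isProxStep_iff {d : ℕ} {X : Set (Vec d)} {r : Vec d → ℝ} {η a : ℝ}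
    (h : ProxRegular X r η a) (v x z : Vec d) :
    IsProxStep X r a v x z ↔ z = proxMap X r a (x - a • v) := by
  have e : ∀ z, IsMinOn (fun y => r y + 1 / (2 * a) * ‖y - (x - a • v)‖ ^ 2) X z ↔
      IsMinOn (fun y => ⟪v, y⟫ + r y + 1 / (2 * a) * ‖y - x‖ ^ 2) X z := by
    intro z
    simp only [isMinOn_iff, prox_objective_completion r h.lam_pos, add_le_add_iff_right]
  constructor
  · exact fun hz => h.eq_prox hz.1 ((e z).2 hz.2)
  · rintro rfl
    exact ⟨(h.prox_spec _).1, (e _).1 (h.prox_spec _).2⟩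

/-- The three-point inequality of the proximal step. -/
theorem IsProxStep.three_point {d : ℕ} {X : Set (Vec d)} {r : Vec d → ℝ} {η a : ℝ}
    (hr : WeaklyConvexOn X η r) (ha : 0 < a) {v x x' z : Vec d}
    (hs : IsProxStep X r a v x x') (hz : z ∈ X) :
    (1 - a * η) * ‖z - x'‖ ^ 2 + ‖x' - x‖ ^ 2 ≤
      ‖z - x‖ ^ 2 + 2 * a * (⟪v, z - x'⟫ + r z - r x') := by
  have h := hs.2.quadratic_growth (hr.prox_objective a v x) hs.1 hz
  have h2 := mul_le_mul_of_nonneg_left h (by positivity : 0 ≤ 2 * a)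
  have e1 : ∀ t, 2 * a * (1 / (2 * a) * t) = t := fun t => by field_simp
  have e2 : ∀ t, 2 * a * ((1 / a - η) / 2 * t) = (1 - a * η) * t := fun t => by field_simp
  simp only [mul_add, e1, e2] at h2
  rw [inner_sub_right]
  linarith

/-- The three-point inequality, with `r` at the new point bounded through a subgradient at the old
one. -/
theorem IsProxStep.three_point_subgradient {d : ℕ} {X : Set (Vec d)} {r : Vec d → ℝ} {η a : ℝ}
    (hr : WeaklyConvexOn X η r) (ha : 0 < a) (haη : a * η < 1) {v x x' z h : Vec d}
    (hs : IsProxStep X r a v x x') (hz : z ∈ X) (hh : h ∈ weakSubdiff X η r x) :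
    (1 - a * η) * ‖z - x'‖ ^ 2 ≤
      ‖z - x‖ ^ 2 + 2 * a * (⟪v, z - x⟫ + r z - r x) + a ^ 2 * ‖v + h‖ ^ 2 / (1 - a * η) := by
  have h1 := hs.three_point hr ha hz
  have h2 := mem_weakSubdiff_iff.1 hh x' hs.1
  have h3 : ⟪v, z - x'⟫ = ⟪v, z - x⟫ - ⟪v + h, x' - x⟫ + ⟪h, x' - x⟫ := by
    simp only [inner_add_left, inner_sub_right]
    ring
  have h4 : -⟪v + h, x' - x⟫ ≤ ‖v + h‖ * ‖x' - x‖ :=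
    (neg_le_abs _).trans (abs_real_inner_le_norm _ _)
  have hδ : 0 < 1 - a * η := by linarith
  have h5 : 2 * a * (‖v + h‖ * ‖x' - x‖) - (1 - a * η) * ‖x' - x‖ ^ 2
      ≤ a ^ 2 * ‖v + h‖ ^ 2 / (1 - a * η) := by
    rw [le_div_iff₀ hδ]
    nlinarith [sq_nonneg (a * ‖v + h‖ - (1 - a * η) * ‖x' - x‖)]
  have h6 : 2 * a * (⟪v, z - x'⟫ + r z - r x') ≤
      2 * a * (⟪v, z - x⟫ + r z - r x + ‖v + h‖ * ‖x' - x‖ + η / 2 * ‖x' - x‖ ^ 2) := by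
    refine mul_le_mul_of_nonneg_left ?_ (by positivity)
    linarith
  nlinarith

theorem IsProxStep.norm_sub_le {d : ℕ} {X : Set (Vec d)} {r : Vec d → ℝ} {η a : ℝ}
    (hr : WeaklyConvexOn X η r) (ha : 0 < a) (haη : a * η < 1) {v x x' h : Vec d}
    (hs : IsProxStep X r a v x x') (hx : x ∈ X) (hh : h ∈ weakSubdiff X η r x) :
    ‖x' - x‖ ≤ a * ‖v + h‖ / (1 - a * η) := by
  have h1 := hs.three_point_subgradient hr ha haη hx hh
  have hδ : 0 < 1 - a * η := by linarith
  rw [sub_self, norm_zero, inner_zero_right, norm_sub_rev] at h1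
  rw [le_div_iff₀ hδ]
  refine le_of_sq_le_sq ?_ (by positivity)
  have h2 : (1 - a * η) * ‖x' - x‖ ^ 2 ≤ a ^ 2 * ‖v + h‖ ^ 2 / (1 - a * η) := by linarith
  rw [le_div_iff₀ hδ] at h2
  nlinarith

namespace StoProblem

variable {d : ℕ} {S : Type*} [MeasurableSpace S] {P : Measure S}
  {X : Set (Vec d)} {F r φ : Vec d → ℝ} {ρ η lam : ℝ} {xstar : Vec d} {g : ℕ → Vec d → S → Vec d}

theorem proxRegular (h : StoProblem P X F r φ ρ η lam xstar g) :
    ProxRegular X φ (ρ + η) lam := by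
  have e : φ = fun x => F x + r x := funext h.eq_add
  refine ⟨h.closed, ⟨_, h.xstar_mem⟩, ?_, ?_, h.lam_pos, ?_⟩
  · rw [e]
    exact (lowerSemicontinuousOn_of_quadratic_support (h.support 0)).add h.r_lsc
  · have := (weaklyConvexOn_of_quadratic_support h.convex (h.support 0)).add h.r_wc
    refine ConvexOn.congr this fun x _ => ?_
    simp only [Pi.add_apply, h.eq_add]
    ring
  · nlinarith [h.lam_lt, h.lam_pos, h.eta_nonneg, mul_nonneg h.lam_pos.le h.eta_nonneg]

theorem modulus_pos (h : StoProblem P X F r φ ρ η lam xstar g) : 0 < 1 / lam - ρ - 2 * η := by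
  have := h.lam_pos
  have h1 : ρ + 2 * η < 1 / lam := by
    rw [lt_div_iff₀ this]
    linarith [h.lam_lt]
  linarith

theorem proxRegular_r (h : StoProblem P X F r φ ρ η lam xstar g) {a : ℝ} (ha : 0 < a)
    (haη : a * η < 1) : ProxRegular X r η a :=
  ⟨h.closed, ⟨_, h.xstar_mem⟩, h.r_lsc, h.r_wc, ha, haη⟩

theorem envGap_eq (h : StoProblem P X F r φ ρ η lam xstar g) (x : Vec d) :
    envGap X φ lam xstar x = (φ (proxMap X φ lam x) - φ xstar)
      + 1 / (2 * lam) * ‖proxMap X φ lam x - x‖ ^ 2 := by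
  rw [envGap, h.proxRegular.moreauEnv_eq]
  ring

theorem le_prox (h : StoProblem P X F r φ ρ η lam xstar g) (x : Vec d) :
    φ xstar ≤ φ (proxMap X φ lam x) :=
  h.isMinOn (h.proxRegular.prox_spec x).1

theorem norm_prox_sub_sq_le (h : StoProblem P X F r φ ρ η lam xstar g) (x : Vec d) :
    ‖proxMap X φ lam x - x‖ ^ 2 ≤ 2 * lam * envGap X φ lam xstar x := by
  have hl := h.lam_pos
  have h1 := h.le_prox x
  have e : ∀ t, 2 * lam * (1 / (2 * lam) * t) = t := fun t => by field_simp
  rw [h.envGap_eq, mul_add, e]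
  have : 0 ≤ 2 * lam * (φ (proxMap X φ lam x) - φ xstar) :=
    mul_nonneg (by positivity) (by linarith)
  linarith

theorem envGap_nonneg (h : StoProblem P X F r φ ρ η lam xstar g) (x : Vec d) :
    0 ≤ envGap X φ lam xstar x := by
  have h1 := (sq_nonneg _).trans (h.norm_prox_sub_sq_le x)
  have : 0 < 2 * lam := by linarith [h.lam_pos]
  exact nonneg_of_mul_nonneg_right h1 this

theorem envGap_le (h : StoProblem P X F r φ ρ η lam xstar g) (x : Vec d) {y : Vec d}
    (hy : y ∈ X) :
    envGap X φ lam xstar x ≤ (φ y - φ xstar) + 1 / (2 * lam) * ‖y - x‖ ^ 2 := by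
  have := h.proxRegular.moreauEnv_le x hy
  rw [envGap]
  linarith

theorem continuous_envGap (h : StoProblem P X F r φ ρ η lam xstar g) :
    Continuous (envGap X φ lam xstar) :=
  h.proxRegular.differentiable_moreauEnv.continuous.sub continuous_const

theorem norm_gradient_sq (h : StoProblem P X F r φ ρ η lam xstar g) (x : Vec d) :
    ‖∇ (moreauEnv X φ lam) x‖ ^ 2 = (1 / lam) ^ 2 * ‖proxMap X φ lam x - x‖ ^ 2 := by
  rw [h.proxRegular.norm_gradient, mul_pow]

theorem norm_gradient_sq_le (h : StoProblem P X F r φ ρ η lam xstar g) (x : Vec d) :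
    ‖∇ (moreauEnv X φ lam) x‖ ^ 2 ≤ 2 / lam * envGap X φ lam xstar x := by
  have hl := h.lam_pos
  rw [h.norm_gradient_sq]
  calc _ ≤ (1 / lam) ^ 2 * (2 * lam * envGap X φ lam xstar x) := by
        gcongr
        exact h.norm_prox_sub_sq_le x
    _ = _ := by field_simp

/-- `(B'_4)` is a special case of `(B'_3)`, as `‖∇φ_λ‖² ≤ (2/λ)(φ_λ - φ*)`. -/
theorem boundThree_of_boundFour (h : StoProblem P X F r φ ρ η lam xstar g)
    (hb : BoundFour P X η r φ lam g) : BoundThree P X η r φ (φ xstar) lam g := by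
  obtain ⟨c₅, c₆, h5, h6, hb⟩ := hb
  have hl := h.lam_pos
  refine ⟨c₅ * (2 / lam), c₆, by positivity, h6, fun k x hx => ?_⟩
  obtain ⟨v, hv, hi, hle⟩ := hb k x hx
  refine ⟨v, hv, hi, hle.trans ?_⟩
  have := mul_le_mul_of_nonneg_left (h.norm_gradient_sq_le x) h5
  rw [envGap] at this
  linarith

/-- From the pointwise bound of the gap after a step by an integrable function to the integral
inequality. The gap itself is not assumed integrable. -/
theorem lintegral_gap_le (h : StoProblem P X F r φ ρ η lam xstar g) {x' : S → Vec d} {Ψ : S → ℝ}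
    {A B : ℝ} (hA : 0 ≤ A)
    (hΨ : Integrable Ψ P) (hle : ∀ s, envGap X φ lam xstar (x' s) + 1 ≤ Ψ s)
    (hint : ∫ s, Ψ s ∂P ≤ B - A) :
    (∫⁻ s, ENNReal.ofReal (envGap X φ lam xstar (x' s) + 1) ∂P) + ENNReal.ofReal A ≤
      ENNReal.ofReal B := by
  have h0 : ∀ s, 0 ≤ Ψ s := fun s =>
    (add_nonneg (h.envGap_nonneg _) zero_le_one).trans (hle s)
  calc _ ≤ (∫⁻ s, ENNReal.ofReal (Ψ s) ∂P) + ENNReal.ofReal A := by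
        gcongr with s
        exact hle s
    _ = ENNReal.ofReal (∫ s, Ψ s ∂P) + ENNReal.ofReal A := by
        rw [ofReal_integral_eq_lintegral_ofReal hΨ (ae_of_all _ h0)]
    _ = ENNReal.ofReal ((∫ s, Ψ s ∂P) + A) := (ENNReal.ofReal_add (integral_nonneg h0) hA).symm
    _ ≤ _ := ENNReal.ofReal_le_ofReal (by linarith)

/-- The coefficient of `a ‖∇φ_λ(x)‖²` in the expected descent of a step of size `a`. -/
noncomputable def descentCoeff (ρ η lam : ℝ) : ℝ := (1 - lam * (ρ + 2 * η)) / 2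

theorem descentCoeff_pos (h : StoProblem P X F r φ ρ η lam xstar g) :
    0 < descentCoeff ρ η lam := by
  have := h.lam_lt
  rw [descentCoeff]
  linarith

theorem descent_eq (h : StoProblem P X F r φ ρ η lam xstar g) (a : ℝ) (x : Vec d) :
    descentCoeff ρ η lam * a * ‖∇ (moreauEnv X φ lam) x‖ ^ 2 =
      1 / (2 * lam) * (a * (1 / lam - ρ - 2 * η)) * ‖proxMap X φ lam x - x‖ ^ 2 := by
  have hl := h.lam_pos
  rw [h.norm_gradient_sq, descentCoeff]
  field_simp
  ring

theorem integral_inner_g (h : StoProblem P X F r φ ρ η lam xstar g) (k : ℕ) {x : Vec d}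
    (hx : x ∈ X) (v : Vec d) : ∫ s, ⟪g k x s, v⟫ ∂P = ⟪∫ s, g k x s ∂P, v⟫ := by
  simp_rw [real_inner_comm v]
  exact integral_inner (h.g_int k x hx) _

theorem integrable_affine [IsProbabilityMeasure P] {u q : S → ℝ} (hu : Integrable u P)
    (hq : Integrable q P) (A B C : ℝ) :
    Integrable (fun s => A + B * u s + C * q s) P ∧
      ∫ s, A + B * u s + C * q s ∂P = A + B * ∫ s, u s ∂P + C * ∫ s, q s ∂P := by
  have hA : Integrable (fun _ : S => A) P := integrable_const A
  have h1 : Integrable (fun s => A + B * u s) P := hA.add (hu.const_mul B)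
  refine ⟨h1.add (hq.const_mul C), ?_⟩
  rw [integral_add h1 (hq.const_mul C), integral_add hA (hu.const_mul B), integral_const_mul,
    integral_const_mul]
  simp

/-- One step under `(B'_3)`. The comparison point is the proximal point of the old iterate. -/
theorem descent_of_boundThree [IsProbabilityMeasure P]
    (h : StoProblem P X F r φ ρ η lam xstar g)
    (hb : BoundThree P X η r φ (φ xstar) lam g) :
    ∃ C : ℝ, 0 < C ∧ ∀ k, ∀ a : ℝ, 0 < a → 6 * η * a < 1 → ∀ x ∈ X, ∀ x' : S → Vec d,
      (∀ s, IsProxStep X r a (g k x s) x (x' s)) →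
      (∫⁻ s, ENNReal.ofReal (envGap X φ lam xstar (x' s) + 1) ∂P)
        + ENNReal.ofReal (descentCoeff ρ η lam * a * ‖∇ (moreauEnv X φ lam) x‖ ^ 2) ≤
        ENNReal.ofReal ((1 + C * a ^ 2) * (envGap X φ lam xstar x + 1)) := by
  obtain ⟨c₃, c₄, h3, h4, hb⟩ := hb
  have hl := h.lam_pos
  refine ⟨1 / lam * (c₃ + c₄) + 1, by positivity, fun k a ha haη x hx x' hs => ?_⟩
  obtain ⟨w, hw, hwi, hwle⟩ := hb k x hx
  have hη := h.eta_nonneg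
  have hδ0 : 5 / 6 < 1 - a * η := by linarith
  have hδ1 : 1 - a * η ≤ 1 := by linarith [mul_nonneg ha.le h.eta_nonneg]
  have hV := h.envGap_eq x
  have hV0 := h.envGap_nonneg x
  have hφ := h.le_prox x
  have hp := (h.proxRegular.prox_spec x).1
  have hgrow := h.proxRegular.growth x hx
  have hm := h.modulus_pos
  have hdesc := h.descent_eq a x
  have hsup := h.support k x hx _ hp
  rw [sub_self, norm_zero, norm_sub_rev x, h.eq_add, h.eq_add x] at hgrow
  rw [show moreauEnv X φ lam x - φ xstar = envGap X φ lam xstar x from rfl] at hwle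
  set p := proxMap X φ lam x
  set Q := ‖p - x‖ ^ 2
  have hQ : 0 ≤ Q := sq_nonneg _
  set δ := 1 - a * η with hδdef
  have hδ : 0 < δ := by linarith
  have hδinv : 1 ≤ δ⁻¹ := (one_le_inv₀ hδ).2 hδ1
  have hδinv2 : δ⁻¹ ≤ 6 / 5 := by
    rw [inv_le_comm₀ hδ (by norm_num)]
    linarith
  set V := envGap X φ lam xstar x
  have hI := h.integral_inner_g k hx (p - x)
  set κ := 1 / (2 * lam) with hκdef
  have hκ : 0 < κ := by positivity
  have hκ2 : 1 / lam = 2 * κ := by rw [hκdef]; field_simp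
  have haff := integrable_affine ((h.g_int k x hx).inner_const (p - x)) hwi
    ((φ p - φ xstar + 1) + κ * δ⁻¹ * (Q + 2 * a * (r p - r x))) (κ * δ⁻¹ * (2 * a))
    (κ * δ⁻¹ * (a ^ 2 * δ⁻¹))
  refine h.lintegral_gap_le ?_ haff.1 ?_ ?_
  · rw [hdesc]
    positivity
  · intro s
    have h1 := (hs s).three_point_subgradient h.r_wc ha (by linarith) hp hw
    have h2 := h.envGap_le (x' s) hp
    rw [div_eq_mul_inv] at h1
    have h5 : ‖p - x' s‖ ^ 2 ≤ δ⁻¹ *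
        (Q + 2 * a * (⟪g k x s, p - x⟫ + r p - r x) + a ^ 2 * ‖g k x s + w‖ ^ 2 * δ⁻¹) := by
      rw [← div_eq_inv_mul, le_div_iff₀ hδ]
      linarith
    have h6 := mul_le_mul_of_nonneg_left h5 hκ.le
    linarith
  · rw [haff.2, hI, hdesc]
    set I := ⟪∫ s, g k x s ∂P, p - x⟫
    set W := ∫ s, ‖g k x s + w‖ ^ 2 ∂P
    have hW : W ≤ (c₃ + c₄) * (V + 1) := by nlinarith [mul_nonneg h4 hV0]
    rw [hκ2] at hm hgrow ⊢
    have h1 : Q + 2 * a * (I + (r p - r x)) ≤ Q * δ - 2 * a * (2 * κ - ρ - η) * Q := by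
      have h2 : I + (r p - r x) ≤ -(2 * κ - ρ - η / 2) * Q := by linarith
      have h3 := mul_le_mul_of_nonneg_left h2 (by positivity : 0 ≤ 2 * a)
      rw [hδdef]
      linarith
    have h2 : κ * δ⁻¹ * (Q + 2 * a * (I + (r p - r x))) ≤
        κ * Q - κ * (a * (2 * κ - ρ - 2 * η)) * Q := by
      have h3 := mul_le_mul_of_nonneg_left h1 (by positivity : 0 ≤ κ * δ⁻¹)
      have e : κ * δ⁻¹ * (Q * δ - 2 * a * (2 * κ - ρ - η) * Q)
          = κ * Q - δ⁻¹ * (2 * κ * a * (2 * κ - ρ - η) * Q) := by field_simp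
      have h4 : 0 ≤ 2 * κ * a * (2 * κ - ρ - η) * Q := by
        have : 0 < 2 * κ - ρ - η := by linarith
        positivity
      have h5 := mul_le_mul_of_nonneg_right hδinv h4
      have h6 : 0 ≤ κ * a * Q * (2 * κ - ρ) := by
        have : 0 < 2 * κ - ρ := by linarith
        positivity
      linarith
    have h3 : κ * δ⁻¹ * (a ^ 2 * δ⁻¹) * W ≤ 2 * κ * (c₃ + c₄) * a ^ 2 * (V + 1) := by
      have h4 : δ⁻¹ * δ⁻¹ ≤ 2 := by nlinarith
      have h5 : 0 ≤ κ * a ^ 2 := by positivity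
      calc κ * δ⁻¹ * (a ^ 2 * δ⁻¹) * W
          ≤ κ * δ⁻¹ * (a ^ 2 * δ⁻¹) * ((c₃ + c₄) * (V + 1)) := by gcongr
        _ = (κ * a ^ 2 * ((c₃ + c₄) * (V + 1))) * (δ⁻¹ * δ⁻¹) := by ring
        _ ≤ (κ * a ^ 2 * ((c₃ + c₄) * (V + 1))) * 2 := by gcongr
        _ = _ := by ring
    have h7 : 0 ≤ a ^ 2 * (V + 1) := by positivity
    linarith

/-- The stochastic subgradients are square integrable under `(B'_{D-D})`, uniformly on `X`. -/
theorem boundDD_moments [IsProbabilityMeasure P] (h : StoProblem P X F r φ ρ η lam xstar g)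
    (hb : BoundDD P X g) :
    ∃ M : ℝ, 0 < M ∧ ∀ k, ∀ x ∈ X, ‖∫ s, g k x s ∂P‖ ≤ M ∧
      Integrable (fun s => ‖g k x s‖ ^ 2) P ∧ ∫ s, ‖g k x s‖ ^ 2 ∂P ≤ M := by
  obtain ⟨Lf, L, hLf, hL, hL2, hb⟩ := hb
  have hL1 : Integrable L P := hL.integrable one_le_two
  have hLsq : Integrable (fun s => L s ^ 2) P := hL.integrable_sq
  refine ⟨|∫ s, L s ∂P| + Lf ^ 2 + 1, by positivity, fun k x hx => ?_⟩
  have hle : ∀ s, ‖g k x s‖ ^ 2 ≤ L s ^ 2 := fun s =>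
    pow_le_pow_left₀ (norm_nonneg _) (hb k x hx s) 2
  have hi : Integrable (fun s => ‖g k x s‖ ^ 2) P := by
    refine hLsq.mono' ((h.g_int k x hx).1.norm.pow 2) (ae_of_all _ fun s => ?_)
    rw [Real.norm_eq_abs, abs_of_nonneg (by positivity)]
    exact hle s
  refine ⟨?_, hi, ?_⟩
  · have h1 := norm_integral_le_of_norm_le hL1 (ae_of_all _ (hb k x hx))
    have h2 := le_abs_self (∫ s, L s ∂P)
    have h3 : 0 ≤ Lf ^ 2 := sq_nonneg _
    linarith
  · have h1 := integral_mono hi hLsq hle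
    have h2 := abs_nonneg (∫ s, L s ∂P)
    linarith

theorem linear_sub_sq_le (a b t : ℝ) {c : ℝ} (hc : 1 / 2 ≤ c) :
    2 * a * (b * t) - c * t ^ 2 ≤ 2 * a ^ 2 * b ^ 2 := by
  have h1 : 0 ≤ (c - 1 / 2) * t ^ 2 := mul_nonneg (by linarith) (sq_nonneg _)
  have h2 := sq_nonneg (2 * a * b - t)
  linarith

/-- The arithmetic of the descent estimate under `(B'_{D-D})`: `κ = 1/(2λ)`, `Q` is the squared
distance to the proximal point, `V` the envelope gap, `Δ` the mean decrease of `F`, and `W` the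
second moment of the subgradient. -/
theorem boundDD_arith {a η ρ κ M D Q V B Δ W I : ℝ} (ha : 0 < a) (hη : 0 ≤ η) (hκ : 0 < κ)
    (hm : 0 < 2 * κ - ρ - 2 * η) (hM : 0 < M) (hD1 : 1 ≤ D) (hD2 : D ≤ 2) (hQ : 0 ≤ Q)
    (hV : V = B + κ * Q) (hV0 : 0 ≤ V) (hD : D = 1 + a * (2 * κ - ρ - 2 * η))
    (hI : I + Δ ≤ ρ / 2 * Q) (hW : W ≤ M) :
    (B + 1) + κ * D⁻¹ * ((1 - a * (2 * κ)) * Q + 2 * a * Δ + 4 * a ^ 2 * M ^ 2)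
        + κ * D⁻¹ * (2 * a) * I + κ * D⁻¹ * (4 * a ^ 2) * W ≤
      (1 + (2 * κ * (2 * M + 2 * M ^ 2) + 1) * a ^ 2) * (V + 1)
        - κ * (a * (2 * κ - ρ - 2 * η)) * Q := by
  have hDinv : 1 / 2 ≤ D⁻¹ := by
    rw [one_div]
    gcongr
  have hDinv1 : D⁻¹ ≤ 1 := inv_le_one_of_one_le₀ hD1
  have hED : D⁻¹ * D = 1 := inv_mul_cancel₀ (by linarith)
  set E := D⁻¹
  have h1 : (1 - a * (2 * κ)) * Q + 2 * a * Δ + 4 * a ^ 2 * M ^ 2 + 2 * a * I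
      + 4 * a ^ 2 * W ≤ D * Q - a * (4 * κ - 2 * ρ - 2 * η) * Q + 4 * a ^ 2 * (M + M ^ 2) := by
    have h2 : 2 * a * (I + Δ) ≤ 2 * a * (ρ / 2 * Q) :=
      mul_le_mul_of_nonneg_left (by linarith) (by positivity)
    have h3 : 4 * a ^ 2 * W ≤ 4 * a ^ 2 * M := by gcongr
    rw [hD]
    linarith
  have h2 := mul_le_mul_of_nonneg_left h1 (by positivity : 0 ≤ κ * E)
  have e : κ * E * (D * Q - a * (4 * κ - 2 * ρ - 2 * η) * Q + 4 * a ^ 2 * (M + M ^ 2)) =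
      κ * Q - E * (κ * a * (4 * κ - 2 * ρ - 2 * η) * Q) + E * (4 * κ * a ^ 2 * (M + M ^ 2)) := by
    linear_combination κ * Q * hED
  rw [e] at h2
  have h3 : 1 / 2 * (κ * a * (4 * κ - 2 * ρ - 2 * η) * Q) ≤
      E * (κ * a * (4 * κ - 2 * ρ - 2 * η) * Q) := by
    refine mul_le_mul_of_nonneg_right hDinv ?_
    have : 0 < 4 * κ - 2 * ρ - 2 * η := by linarith
    positivity
  have h4 : E * (4 * κ * a ^ 2 * (M + M ^ 2)) ≤ 1 * (4 * κ * a ^ 2 * (M + M ^ 2)) :=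
    mul_le_mul_of_nonneg_right hDinv1 (by positivity)
  have h5 : 0 ≤ κ * a * η * Q := by positivity
  have h6 : 0 ≤ a ^ 2 * (V + 1) := by positivity
  have h7 : 0 ≤ (4 * κ * a ^ 2 * (M + M ^ 2)) * V := by positivity
  linarith

/-- One step under `(B'_{D-D})`. The value of `r` at the new iterate is controlled by the growth of
the proximal objective of `φ` around the proximal point, and the increments of `F` by its mean
subgradient at the new iterate. -/
theorem descent_of_boundDD [IsProbabilityMeasure P]
    (h : StoProblem P X F r φ ρ η lam xstar g) (hb : BoundDD P X g) :
    ∃ C : ℝ, 0 < C ∧ ∀ k, ∀ a : ℝ, 0 < a → a < 1 / (2 * (ρ + 2 * η + 1 / lam)) → ∀ x ∈ X,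
      ∀ x' : S → Vec d, (∀ s, IsProxStep X r a (g k x s) x (x' s)) →
      (∫⁻ s, ENNReal.ofReal (envGap X φ lam xstar (x' s) + 1) ∂P)
        + ENNReal.ofReal (descentCoeff ρ η lam * a * ‖∇ (moreauEnv X φ lam) x‖ ^ 2) ≤
        ENNReal.ofReal ((1 + C * a ^ 2) * (envGap X φ lam xstar x + 1)) := by
  obtain ⟨M, hM0, hM⟩ := h.boundDD_moments hb
  have hl := h.lam_pos
  refine ⟨1 / lam * (2 * M + 2 * M ^ 2) + 1, by positivity, fun k a ha haη x hx x' hs => ?_⟩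
  obtain ⟨-, hwi, hwle⟩ := hM k x hx
  have hη := h.eta_nonneg
  have hρ := h.rho_nonneg
  have hV := h.envGap_eq x
  have hV0 := h.envGap_nonneg x
  have hφ := h.le_prox x
  have hp := (h.proxRegular.prox_spec x).1
  have hm := h.modulus_pos
  have hdesc := h.descent_eq a x
  have hsup := h.support k x hx _ hp
  rw [lt_div_iff₀ (by positivity)] at haη
  have hgrow := fun y (hy : y ∈ X) => h.proxRegular.growth x hy
  simp only [h.eq_add _] at hgrow
  rw [h.eq_add] at hφ hV
  set p := proxMap X φ lam x
  set Q := ‖p - x‖ ^ 2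
  have hQ : 0 ≤ Q := sq_nonneg _
  set V := envGap X φ lam xstar x
  have hI := h.integral_inner_g k hx (p - x)
  set κ := 1 / (2 * lam) with hκdef
  have hκ : 0 < κ := by positivity
  have hκ2 : 1 / lam = 2 * κ := by rw [hκdef]; field_simp
  rw [hκ2] at hm haη
  set D := 1 + a * (2 * κ - ρ - 2 * η) with hDdef
  have hD1 : 1 ≤ D := by
    have : 0 ≤ a * (2 * κ - ρ - 2 * η) := by positivity
    linarith
  have hD2 : D ≤ 2 := by nlinarith [mul_nonneg ha.le hη, mul_nonneg ha.le hρ]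
  have hD : 0 < D := by linarith
  have haff := integrable_affine ((h.g_int k x hx).inner_const (p - x)) hwi
    ((F p + r p - φ xstar + 1) + κ * D⁻¹ * ((1 - a * (2 * κ)) * Q + 2 * a * (F x - F p)
      + 4 * a ^ 2 * M ^ 2)) (κ * D⁻¹ * (2 * a)) (κ * D⁻¹ * (4 * a ^ 2))
  refine h.lintegral_gap_le ?_ haff.1 ?_ ?_
  · rw [hdesc, hκ2]
    positivity
  · intro s
    have h1 := (hs s).three_point h.r_wc ha hp
    have h2 := h.envGap_le (x' s) hp
    have h3 := hgrow _ (hs s).1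
    -- The subgradient of `F` is taken at the new iterate, where its norm is also at most `M`.
    have h4 := h.support k _ (hs s).1 x hx
    have h5 := (hM k _ (hs s).1).1
    have h6 : -⟪∫ s', g k (x' s) s' ∂P, x - x' s⟫ ≤ M * ‖x' s - x‖ := by
      refine (neg_le_abs _).trans ((abs_real_inner_le_norm _ _).trans ?_)
      rw [norm_sub_rev x]
      gcongr
    have h7 : -⟪g k x s, x' s - x⟫ ≤ ‖g k x s‖ * ‖x' s - x‖ :=
      (neg_le_abs _).trans (abs_real_inner_le_norm _ _)
    have h8 : ⟪g k x s, p - x' s⟫ = ⟪g k x s, p - x⟫ - ⟪g k x s, x' s - x⟫ := by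
      simp only [inner_sub_right]
      ring
    rw [h8] at h1
    rw [norm_sub_rev (x' s) p, hκ2] at h3
    rw [norm_sub_rev x] at h4
    rw [h.eq_add p] at h2
    set t := ‖x' s - x‖
    set n := ‖g k x s‖
    set Z := ‖p - x' s‖ ^ 2
    set u := ⟪g k x s, p - x⟫
    have h9 : 2 * a * (u - ⟪g k x s, x' s - x⟫ + r p - r (x' s)) ≤
        2 * a * (u + F x - F p + (n + M) * t + ρ / 2 * t ^ 2 + κ * t ^ 2 - κ * Q
          - (2 * κ - (ρ + η)) / 2 * Z) := by
      refine mul_le_mul_of_nonneg_left ?_ (by positivity)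
      linarith
    have h10 := linear_sub_sq_le a (n + M) t
      (by linarith [mul_nonneg ha.le hη] : 1 / 2 ≤ 1 - a * ρ - 2 * a * κ)
    have h13 : 2 * a ^ 2 * (n + M) ^ 2 ≤ 2 * a ^ 2 * (2 * (n ^ 2 + M ^ 2)) := by
      gcongr
      exact add_sq_le
    have h11 : Z ≤ D⁻¹ * ((1 - a * (2 * κ)) * Q + 2 * a * (F x - F p) + 4 * a ^ 2 * M ^ 2
        + 2 * a * u + 4 * a ^ 2 * n ^ 2) := by
      rw [← div_eq_inv_mul, le_div_iff₀ hD, hDdef]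
      linarith
    have h12 := mul_le_mul_of_nonneg_left h11 hκ.le
    linarith
  · rw [haff.2, hI, hdesc]
    rw [hκ2]
    exact boundDD_arith ha hη hκ hm hM0 hD1 hD2 hQ hV hV0 hDdef (by linarith) hwle

theorem lt_one_of_admissibleStep (h : StoProblem P X F r φ ρ η lam xstar g) {a : ℝ} (ha : 0 < a)
    (had : AdmissibleStep P X ρ η r φ (φ xstar) lam g a) : a * η < 1 := by
  have hl := h.lam_pos
  have hη := h.eta_nonneg
  have hρ := h.rho_nonneg
  rcases had with ⟨-, had⟩ | ⟨-, had⟩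
  · rw [lt_div_iff₀ (by positivity)] at had
    have : 0 < a * (1 / lam) := by positivity
    linarith [mul_nonneg ha.le hρ, mul_nonneg ha.le hη]
  · linarith [mul_nonneg ha.le hη]

/-- The expected descent of the envelope gap in one step of admissible size, with error constant
`C`. Adding `1` to the gap absorbs the additive error term into the factor `1 + C a²`. -/
def DescentWith (P : Measure S) (X : Set (Vec d)) (r φ : Vec d → ℝ) (ρ η lam : ℝ)
    (xstar : Vec d) (g : ℕ → Vec d → S → Vec d) (C : ℝ) : Prop :=
  ∀ k, ∀ a : ℝ, 0 < a → AdmissibleStep P X ρ η r φ (φ xstar) lam g a → ∀ x ∈ X,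
    (∫⁻ s, ENNReal.ofReal (envGap X φ lam xstar (proxMap X r a (x - a • g k x s)) + 1) ∂P)
      + ENNReal.ofReal (descentCoeff ρ η lam * a * ‖∇ (moreauEnv X φ lam) x‖ ^ 2) ≤
      ENNReal.ofReal ((1 + C * a ^ 2) * (envGap X φ lam xstar x + 1))

theorem descent [IsProbabilityMeasure P] (h : StoProblem P X F r φ ρ η lam xstar g) :
    ∃ C : ℝ, 0 < C ∧ DescentWith P X r φ ρ η lam xstar g C := by
  have h1 : ∃ C₁ : ℝ, 0 < C₁ ∧ (BoundDD P X g → ∀ k, ∀ a : ℝ, 0 < a →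
      a < 1 / (2 * (ρ + 2 * η + 1 / lam)) → ∀ x ∈ X,
      ∀ x' : S → Vec d, (∀ s, IsProxStep X r a (g k x s) x (x' s)) →
      (∫⁻ s, ENNReal.ofReal (envGap X φ lam xstar (x' s) + 1) ∂P)
        + ENNReal.ofReal (descentCoeff ρ η lam * a * ‖∇ (moreauEnv X φ lam) x‖ ^ 2) ≤
        ENNReal.ofReal ((1 + C₁ * a ^ 2) * (envGap X φ lam xstar x + 1))) := by
    by_cases hb : BoundDD P X g
    · obtain ⟨C, hC, hd⟩ := h.descent_of_boundDD hb
      exact ⟨C, hC, fun _ => hd⟩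
    · exact ⟨1, one_pos, fun hb' => absurd hb' hb⟩
  have h2 : ∃ C₂ : ℝ, 0 < C₂ ∧ (BoundThree P X η r φ (φ xstar) lam g → ∀ k, ∀ a : ℝ, 0 < a →
      6 * η * a < 1 → ∀ x ∈ X,
      ∀ x' : S → Vec d, (∀ s, IsProxStep X r a (g k x s) x (x' s)) →
      (∫⁻ s, ENNReal.ofReal (envGap X φ lam xstar (x' s) + 1) ∂P)
        + ENNReal.ofReal (descentCoeff ρ η lam * a * ‖∇ (moreauEnv X φ lam) x‖ ^ 2) ≤
        ENNReal.ofReal ((1 + C₂ * a ^ 2) * (envGap X φ lam xstar x + 1))) := by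
    by_cases hb : BoundThree P X η r φ (φ xstar) lam g
    · obtain ⟨C, hC, hd⟩ := h.descent_of_boundThree hb
      exact ⟨C, hC, fun _ => hd⟩
    · exact ⟨1, one_pos, fun hb' => absurd hb' hb⟩
  obtain ⟨C₁, hC₁, h1⟩ := h1
  obtain ⟨C₂, hC₂, h2⟩ := h2
  refine ⟨C₁ + C₂, by positivity, fun k a ha had x hx => ?_⟩
  have hstep : ∀ s, IsProxStep X r a (g k x s) x (proxMap X r a (x - a • g k x s)) := fun s =>
    (isProxStep_iff (h.proxRegular_r ha (h.lt_one_of_admissibleStep ha had)) _ _ _).2 rfl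
  have hV := h.envGap_nonneg x
  rcases had with ⟨hb, had⟩ | ⟨hb, had⟩
  · refine (h1 hb k a ha had x hx _ hstep).trans (ENNReal.ofReal_le_ofReal ?_)
    gcongr
    linarith
  · have hb' := hb.elim id h.boundThree_of_boundFour
    refine (h2 hb' k a ha had x hx _ hstep).trans (ENNReal.ofReal_le_ofReal ?_)
    gcongr
    linarith

end StoProblem

/-! ### Integration against a fresh sample -/

/-- A fresh sample can be integrated out first, on any event of the past. -/
theorem setLIntegral_fresh_sample {E S Ω : Type*} [MeasurableSpace E] [MeasurableSpace S]
    {m mΩ : MeasurableSpace Ω} {μ : Measure Ω} [IsProbabilityMeasure μ] {P : Measure S}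
    [IsProbabilityMeasure P] (hm : m ≤ mΩ) {x : Ω → E} {ξ : Ω → S} (hx : Measurable[m] x)
    (hξ : Measurable ξ) (hlaw : μ.map ξ = P)
    (hind : Indep (MeasurableSpace.comap ξ inferInstance) m μ) {A : Set Ω} (hA : MeasurableSet[m] A)
    {ψ : E × S → ENNReal} (hψ : Measurable ψ) :
    ∫⁻ ω in A, ψ (x ω, ξ ω) ∂μ = ∫⁻ ω in A, ∫⁻ s, ψ (x ω, s) ∂P ∂μ := by
  -- The event enters through its indicator, as a further coordinate of the past.
  set Y : Ω → ENNReal × E := fun ω => (A.indicator (fun _ => 1) ω, x ω) with hY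
  have hYm : Measurable[m] Y := (Measurable.indicator measurable_const hA).prodMk hx
  have hYm' : Measurable Y := hYm.mono hm le_rfl
  have hYξ : IndepFun Y ξ μ := by
    rw [IndepFun_iff_Indep]
    exact (indep_of_indep_of_le_right hind hYm.comap_le).symm
  have hmap : μ.map (fun ω => (Y ω, ξ ω)) = (μ.map Y).prod P := by
    rw [← hlaw]
    exact (indepFun_iff_map_prod_eq_prod_map_map hYm'.aemeasurable hξ.aemeasurable).1 hYξ
  set Θ : (ENNReal × E) × S → ENNReal := fun p => p.1.1 * ψ (p.1.2, p.2) with hΘ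
  have hΘm : Measurable Θ := by fun_prop
  have h1 : ∫⁻ ω, Θ (Y ω, ξ ω) ∂μ = ∫⁻ ω, ∫⁻ s, Θ (Y ω, s) ∂P ∂μ := by
    calc ∫⁻ ω, Θ (Y ω, ξ ω) ∂μ = ∫⁻ p, Θ p ∂(μ.map fun ω => (Y ω, ξ ω)) :=
          (lintegral_map hΘm (hYm'.prodMk hξ)).symm
      _ = ∫⁻ y, ∫⁻ s, Θ (y, s) ∂P ∂(μ.map Y) := by
          rw [hmap, lintegral_prod _ hΘm.aemeasurable]
      _ = _ := lintegral_map hΘm.lintegral_prod_right' hYm'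
  have hA' : MeasurableSet A := hm _ hA
  rw [← lintegral_indicator hA', ← lintegral_indicator hA']
  refine Eq.trans (lintegral_congr fun ω => ?_) (h1.trans (lintegral_congr fun ω => ?_))
  · by_cases hω : ω ∈ A <;> simp [Θ, Y, hω]
  · by_cases hω : ω ∈ A <;> simp [Θ, Y, hω]

/-- A discrete Gronwall inequality that also bounds the accumulated decrease. -/
theorem gronwall_add_sum_le {a b : ℕ → ENNReal} {β : ℕ → ℝ} (hβ : ∀ k, 0 ≤ β k) {n : ℕ}
    (h : ∀ k < n, a (k + 1) + b k ≤ ENNReal.ofReal (1 + β k) * a k) :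
    a n + ∑ k ∈ Finset.range n, b k ≤
      ENNReal.ofReal (Real.exp (∑ k ∈ Finset.range n, β k)) * a 0 := by
  induction n with
  | zero => simp
  | succ n ih =>
    have ih := ih fun k hk => h k (by omega)
    have h1 : (1 : ENNReal) ≤ ENNReal.ofReal (1 + β n) := by
      rw [← ENNReal.ofReal_one]
      exact ENNReal.ofReal_le_ofReal (by linarith [hβ n])
    calc a (n + 1) + ∑ k ∈ Finset.range (n + 1), b k
        = (a (n + 1) + b n) + ∑ k ∈ Finset.range n, b k := by
          rw [Finset.sum_range_succ]; ring
      _ ≤ ENNReal.ofReal (1 + β n) * a n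
          + ENNReal.ofReal (1 + β n) * ∑ k ∈ Finset.range n, b k := by
          gcongr
          · exact h n (by omega)
          · exact le_mul_of_one_le_left (by simp) h1
      _ = ENNReal.ofReal (1 + β n) * (a n + ∑ k ∈ Finset.range n, b k) := by ring
      _ ≤ ENNReal.ofReal (Real.exp (β n)) *
          (ENNReal.ofReal (Real.exp (∑ k ∈ Finset.range n, β k)) * a 0) := by
          gcongr
          linarith [Real.add_one_le_exp (β n)]
      _ = _ := by
          rw [← mul_assoc, ← ENNReal.ofReal_mul (Real.exp_nonneg _), ← Real.exp_add,
            Finset.sum_range_succ, add_comm (β n)]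

/-! ### Runs of the method and their expected complexity -/

namespace IsStoSubGradRun

variable {d : ℕ} {S : Type*} [MeasurableSpace S] {P : Measure S}
  {X : Set (Vec d)} {F r φ : Vec d → ℝ} {ρ η lam : ℝ} {xstar : Vec d} {g : ℕ → Vec d → S → Vec d}
  {Ω : Type*} [mΩ : MeasurableSpace Ω] {μ : Measure Ω} {α : ℕ → ℝ}
  {x0 : Vec d} {N : ℕ∞} {ℱ : Filtration ℕ mΩ} {ξ : ℕ → Ω → S} {x : ℕ → Ω → Vec d}

theorem measurable_iterate (hr : IsStoSubGradRun μ P X r g α x0 N ℱ ξ x) {k : ℕ}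
    (hk : (k : ℕ∞) ≤ N) : Measurable (x k) :=
  (hr.iterate_measurable k hk).mono (ℱ.le k) le_rfl

theorem mem (hr : IsStoSubGradRun μ P X r g α x0 N ℱ ξ x) (hx0 : x0 ∈ X) {k : ℕ}
    (hk : (k : ℕ∞) ≤ N) (ω : Ω) : x k ω ∈ X := by
  cases k with
  | zero => rw [hr.init]; exact hx0
  | succ k =>
    refine (hr.step k (lt_of_lt_of_le ?_ hk) ω).1
    exact_mod_cast Nat.lt_succ_self k

theorem setLIntegral_sample [IsProbabilityMeasure P] [IsProbabilityMeasure μ]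
    (hr : IsStoSubGradRun μ P X r g α x0 N ℱ ξ x) {k : ℕ}
    (hk : (k : ℕ∞) < N) {A : Set Ω} (hA : MeasurableSet[ℱ k] A) {ψ : Vec d × S → ENNReal}
    (hψ : Measurable ψ) :
    ∫⁻ ω in A, ψ (x k ω, ξ k ω) ∂μ = ∫⁻ ω in A, ∫⁻ s, ψ (x k ω, s) ∂P ∂μ :=
  setLIntegral_fresh_sample (ℱ.le k) (hr.iterate_measurable k hk.le)
    ((hr.sample_measurable k hk).mono (ℱ.le _) le_rfl) (hr.sample_law k hk) (hr.sample_indep k hk)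
    hA hψ

theorem iterate_succ (hr : IsStoSubGradRun μ P X r g α x0 N ℱ ξ x) {k : ℕ}
    (hk : (k : ℕ∞) < N) (hreg : ProxRegular X r η (α k)) (ω : Ω) :
    x (k + 1) ω = proxMap X r (α k) (x k ω - α k • g k (x k ω) (ξ k ω)) :=
  (isProxStep_iff hreg _ _ _).1 (hr.step k hk ω)

end IsStoSubGradRun

namespace StoProblem

variable {d : ℕ} {S : Type*} [MeasurableSpace S] {P : Measure S}
  {X : Set (Vec d)} {F r φ : Vec d → ℝ} {ρ η lam : ℝ} {xstar : Vec d} {g : ℕ → Vec d → S → Vec d}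
  {Ω : Type*} [mΩ : MeasurableSpace Ω] {μ : Measure Ω} {α : ℕ → ℝ}
  {x0 : Vec d} {N : ℕ∞} {ℱ : Filtration ℕ mΩ} {ξ : ℕ → Ω → S} {x : ℕ → Ω → Vec d}

/-- The descent along a run, localized to an event of the past. -/
theorem setLIntegral_descent [IsProbabilityMeasure P] [IsProbabilityMeasure μ]
    (h : StoProblem P X F r φ ρ η lam xstar g) {C : ℝ} (hC : 0 < C)
    (hd : DescentWith P X r φ ρ η lam xstar g C)
    (hr : IsStoSubGradRun μ P X r g α x0 N ℱ ξ x) (hx0 : x0 ∈ X) {k : ℕ} (hk : (k : ℕ∞) < N)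
    (hα : 0 < α k) (had : AdmissibleStep P X ρ η r φ (φ xstar) lam g (α k))
    {A : Set Ω} (hA : MeasurableSet[ℱ k] A) :
    (∫⁻ ω in A, ENNReal.ofReal (envGap X φ lam xstar (x (k + 1) ω) + 1) ∂μ)
      + ∫⁻ ω in A, ENNReal.ofReal
          (descentCoeff ρ η lam * α k * ‖∇ (moreauEnv X φ lam) (x k ω)‖ ^ 2) ∂μ ≤
      ENNReal.ofReal (1 + C * α k ^ 2) *
        ∫⁻ ω in A, ENNReal.ofReal (envGap X φ lam xstar (x k ω) + 1) ∂μ := by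
  have hreg := h.proxRegular_r hα (h.lt_one_of_admissibleStep hα had)
  have hg : Measurable fun p : Vec d × S => g k p.1 p.2 := h.g_meas k
  have hpm := hreg.continuous_prox.measurable
  have hVm := h.continuous_envGap.measurable
  have hψ : Measurable fun p : Vec d × S =>
      ENNReal.ofReal (envGap X φ lam xstar (proxMap X r (α k) (p.1 - α k • g k p.1 p.2)) + 1) :=
    ((hVm.comp (hpm.comp (measurable_fst.sub (hg.const_smul (α k))))).add_const 1).ennreal_ofReal
  have hxm := hr.measurable_iterate hk.le
  have hV1 : Measurable fun ω => ENNReal.ofReal (envGap X φ lam xstar (x k ω) + 1) :=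
    ((hVm.comp hxm).add_const 1).ennreal_ofReal
  have e : ∀ ω, x (k + 1) ω = proxMap X r (α k) (x k ω - α k • g k (x k ω) (ξ k ω)) :=
    hr.iterate_succ hk hreg
  have hsample := hr.setLIntegral_sample hk hA hψ
  have hint := (hψ.lintegral_prod_right' (ν := P)).comp hxm
  simp only [Function.comp_def] at hsample hint
  simp_rw [e]
  rw [hsample, ← lintegral_add_left hint, ← lintegral_const_mul _ hV1]
  refine lintegral_mono fun ω => (hd k (α k) hα had _ (hr.mem hx0 hk.le ω)).trans ?_
  rw [ENNReal.ofReal_mul (by positivity)]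

theorem continuous_norm_gradient (h : StoProblem P X F r φ ρ η lam xstar g) :
    Continuous fun y => ‖∇ (moreauEnv X φ lam) y‖ := by
  simp_rw [h.proxRegular.norm_gradient]
  exact continuous_const.mul (h.proxRegular.continuous_prox.sub continuous_id).norm

/-- The expected complexity of `T + 1` iterations. -/
theorem min_expected_gradient_le [IsProbabilityMeasure P] [IsProbabilityMeasure μ]
    (h : StoProblem P X F r φ ρ η lam xstar g) {C : ℝ} (hC : 0 < C)
    (hd : DescentWith P X r φ ρ η lam xstar g C)
    (hr : IsStoSubGradRun μ P X r g α x0 N ℱ ξ x) (hx0 : x0 ∈ X) {T : ℕ}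
    (hT : ((T + 1 : ℕ) : ℕ∞) ≤ N) (hα : ∀ k ≤ T, 0 < α k)
    (had : ∀ k ≤ T, AdmissibleStep P X ρ η r φ (φ xstar) lam g (α k)) {K : ℝ}
    (hK : C * ((envGap X φ lam xstar x0 + 1) *
      Real.exp (C * ∑ k ∈ Finset.range (T + 1), α k ^ 2)) ≤ K) :
    (∀ k ≤ T, Integrable (fun ω => ‖∇ (moreauEnv X φ lam) (x k ω)‖ ^ 2) μ) ∧
    (Finset.range (T + 1)).inf' Finset.nonempty_range_add_one
        (fun k => ∫ ω, ‖∇ (moreauEnv X φ lam) (x k ω)‖ ^ 2 ∂μ) ≤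
      2 / (1 - lam * (ρ + 2 * η)) *
        ((envGap X φ lam xstar x0 + K * ∑ k ∈ Finset.range (T + 1), α k ^ 2) /
          ∑ k ∈ Finset.range (T + 1), α k) := by
  set V := envGap X φ lam xstar
  set c := descentCoeff ρ η lam with hc
  have hcpos : 0 < c := h.descentCoeff_pos
  have hVm : Measurable V := h.continuous_envGap.measurable
  have hV0 : ∀ y, 0 ≤ V y := h.envGap_nonneg
  have hltN : ∀ k ≤ T, (k : ℕ∞) < N := fun k hk =>
    lt_of_lt_of_le (by exact_mod_cast Nat.lt_succ_of_le hk) hT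
  have hleN : ∀ k ≤ T + 1, (k : ℕ∞) ≤ N := fun k hk => le_trans (by exact_mod_cast hk) hT
  set u : ℕ → ENNReal := fun k => ∫⁻ ω, ENNReal.ofReal (V (x k ω) + 1) ∂μ with hu
  set b : ℕ → ENNReal := fun k => ∫⁻ ω, ENNReal.ofReal
    (c * α k * ‖∇ (moreauEnv X φ lam) (x k ω)‖ ^ 2) ∂μ with hb
  have hrec : ∀ k ≤ T, u (k + 1) + b k ≤ ENNReal.ofReal (1 + C * α k ^ 2) * u k := by
    intro k hk
    simpa using h.setLIntegral_descent hC hd hr hx0 (hltN k hk) (hα k hk) (had k hk)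
      (A := Set.univ) MeasurableSet.univ
  set S₂ := ∑ k ∈ Finset.range (T + 1), α k ^ 2 with hS₂
  set B := (V x0 + 1) * Real.exp (C * S₂) with hB
  have hu0 : u 0 = ENNReal.ofReal (V x0 + 1) := by simp [u, hr.init]
  have hbound : ∀ k ≤ T + 1, u k ≤ ENNReal.ofReal B := by
    intro k hk
    have h1 := gronwall_add_sum_le (a := u) (b := b) (β := fun k => C * α k ^ 2)
      (fun k => by positivity) (n := k) fun j hj => hrec j (by omega)
    refine (le_self_add.trans h1).trans ?_
    rw [hu0, ← ENNReal.ofReal_mul (Real.exp_nonneg _), mul_comm, hB, ← Finset.mul_sum]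
    refine ENNReal.ofReal_le_ofReal ?_
    have := hV0 x0
    gcongr
    rw [hS₂]
    exact Finset.sum_le_sum_of_subset_of_nonneg (Finset.range_mono hk) fun _ _ _ => sq_nonneg _
  have hxm : ∀ k ≤ T + 1, Measurable fun ω => V (x k ω) + 1 := fun k hk =>
    (hVm.comp (hr.measurable_iterate (hleN k hk))).add_const 1
  have hVint : ∀ k ≤ T + 1, Integrable (fun ω => V (x k ω) + 1) μ := by
    intro k hk
    refine ⟨(hxm k hk).aestronglyMeasurable, ?_⟩
    rw [hasFiniteIntegral_iff_ofReal (ae_of_all _ fun ω => by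
      simp only [Pi.zero_apply]
      linarith [hV0 (x k ω)])]
    exact (hbound k hk).trans_lt ENNReal.ofReal_lt_top
  have hGm : ∀ k ≤ T + 1, Measurable fun ω => ‖∇ (moreauEnv X φ lam) (x k ω)‖ ^ 2 :=
    fun k hk => (h.continuous_norm_gradient.measurable.comp
      (hr.measurable_iterate (hleN k hk))).pow_const 2
  have hlam := h.lam_pos
  have hGint : ∀ k ≤ T + 1, Integrable (fun ω => ‖∇ (moreauEnv X φ lam) (x k ω)‖ ^ 2) μ := by
    intro k hk
    refine ((hVint k hk).const_mul (2 / lam)).mono' (hGm k hk).aestronglyMeasurable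
      (ae_of_all _ fun ω => ?_)
    rw [Real.norm_eq_abs, abs_of_nonneg (by positivity)]
    refine (h.norm_gradient_sq_le _).trans ?_
    gcongr
    exact le_add_of_nonneg_right zero_le_one
  refine ⟨fun k hk => hGint k (by omega), ?_⟩
  set e : ℕ → ℝ := fun k => ∫ ω, V (x k ω) + 1 ∂μ with he
  set G : ℕ → ℝ := fun k => ∫ ω, ‖∇ (moreauEnv X φ lam) (x k ω)‖ ^ 2 ∂μ with hG
  have hue : ∀ k ≤ T + 1, u k = ENNReal.ofReal (e k) := fun k hk =>
    (ofReal_integral_eq_lintegral_ofReal (hVint k hk)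
      (ae_of_all _ fun ω => by simp only [Pi.zero_apply]; linarith [hV0 (x k ω)])).symm
  have hbG : ∀ k ≤ T, b k = ENNReal.ofReal (c * α k * G k) := by
    intro k hk
    have := hα k hk
    rw [hb, hG, ← integral_const_mul]
    exact (ofReal_integral_eq_lintegral_ofReal ((hGint k (by omega)).const_mul _)
      (ae_of_all _ fun ω => by simp only [Pi.zero_apply]; positivity)).symm
  have he1 : ∀ k ≤ T + 1, 1 ≤ e k := by
    intro k hk
    have h1 : ∫ _, (1 : ℝ) ∂μ ≤ e k :=
      integral_mono (integrable_const _) (hVint k hk) fun ω => by linarith [hV0 (x k ω)]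
    simpa using h1
  have hB0 : 0 ≤ B := mul_nonneg (by linarith [hV0 x0]) (Real.exp_nonneg _)
  have heB : ∀ k ≤ T + 1, e k ≤ B := fun k hk =>
    (ENNReal.ofReal_le_ofReal_iff hB0).1 (hue k hk ▸ hbound k hk)
  have hG0 : ∀ k, 0 ≤ G k := fun k => integral_nonneg fun ω => by positivity
  have hreal : ∀ k ≤ T, c * (α k * G k) ≤ e k - e (k + 1) + K * α k ^ 2 := by
    intro k hk
    have h1 := hrec k hk
    have h2 := he1 (k + 1) (by omega)
    have h3 := he1 k (by omega)
    have h4 := hα k hk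
    rw [hue k (by omega), hue (k + 1) (by omega), hbG k hk, ← ENNReal.ofReal_add (by linarith)
      (by have := hG0 k; positivity), ← ENNReal.ofReal_mul (by positivity),
      ENNReal.ofReal_le_ofReal_iff (by positivity)] at h1
    have h5 : C * e k ≤ K := (mul_le_mul_of_nonneg_left (heB k (by omega)) hC.le).trans hK
    have h6 := mul_le_mul_of_nonneg_right h5 (sq_nonneg (α k))
    linarith
  have hsum : c * ∑ k ∈ Finset.range (T + 1), α k * G k ≤ V x0 + K * S₂ := by
    rw [Finset.mul_sum]
    calc _ ≤ ∑ k ∈ Finset.range (T + 1), (e k - e (k + 1) + K * α k ^ 2) :=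
          Finset.sum_le_sum fun k hk => hreal k (by simpa [Nat.lt_succ_iff] using hk)
      _ = e 0 - e (T + 1) + K * S₂ := by
          rw [Finset.sum_add_distrib, Finset.sum_range_sub', ← Finset.mul_sum]
      _ ≤ _ := by
          have h1 := he1 (T + 1) le_rfl
          have h2 : e 0 = V x0 + 1 := by simp [e, hr.init]
          linarith
  set m := (Finset.range (T + 1)).inf' Finset.nonempty_range_add_one G
  have hm : ∀ k ∈ Finset.range (T + 1), m ≤ G k := fun k hk => Finset.inf'_le _ hk
  have hA : 0 < ∑ k ∈ Finset.range (T + 1), α k :=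
    Finset.sum_pos (fun k hk => hα k (by simpa [Nat.lt_succ_iff] using hk))
      Finset.nonempty_range_add_one
  have hmA : m * ∑ k ∈ Finset.range (T + 1), α k ≤ ∑ k ∈ Finset.range (T + 1), α k * G k := by
    rw [Finset.mul_sum]
    refine Finset.sum_le_sum fun k hk => ?_
    rw [mul_comm]
    exact mul_le_mul_of_nonneg_left (hm k hk) (hα k (by simpa [Nat.lt_succ_iff] using hk)).le
  have e1 : 2 / (1 - lam * (ρ + 2 * η)) = 1 / c := by rw [hc, descentCoeff, one_div_div]
  rw [e1, one_div_mul_eq_div, div_div, le_div_iff₀ (by positivity)]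
  have := mul_le_mul_of_nonneg_left hmA hcpos.le
  linarith

end StoProblem

/-! ### Anchored sequences -/

/-- If the distance of `x` to each earlier anchor `q m` increases by little as long as
`‖q j - x j‖ ≥ ε`, and `‖q j - x j‖` is small infinitely often, then it tends to `0`: after the
last visit `m` to `{‖q - x‖ < ε}` the point `x n` stays near the anchor `q m`. -/
theorem tendsto_norm_sub_zero_of_anchored {E : Type*} [NormedAddCommGroup E] {q x : ℕ → E}
    {u : ℕ → ℝ} {L : ℝ} (hu0 : ∀ j, 0 ≤ u j) (hu : Tendsto u atTop (𝓝 0)) (hL0 : 0 ≤ L)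
    (hL : ∀ m n, ‖q n - x n‖ ≤ ‖q m - x m‖ + L * ‖x n - x m‖)
    (hanchor : ∀ m j, m ≤ j → ‖q m - x (j + 1)‖ ^ 2 ≤ ‖q m - x j‖ ^ 2 + u j)
    (hsum : ∀ ε : ℝ, 0 < ε → Summable fun j => if ε ≤ ‖q j - x j‖ then u j else 0)
    (hfreq : ∀ ε : ℝ, 0 < ε → ∃ᶠ k in atTop, ‖q k - x k‖ < ε) :
    Tendsto (fun k => ‖q k - x k‖) atTop (𝓝 0) := by
  rw [Metric.tendsto_atTop]
  intro ε' hε'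
  -- After a visit at level `ε` the distance stays below `ε + L * (3 * ε)`.
  set ε := ε' / (2 * (1 + 3 * L)) with hε
  have hεpos : 0 < ε := by positivity
  set v : ℕ → ℝ := fun j => if ε ≤ ‖q j - x j‖ then u j else 0 with hv
  have hv0 : ∀ j, 0 ≤ v j := fun j => by
    simp only [hv]
    split_ifs
    exacts [hu0 j, le_rfl]
  have htail := (tendsto_sum_nat_add v).eventually_lt_const (by positivity : (0 : ℝ) < ε ^ 2)
  have hsmall : ∀ᶠ j in atTop, u j < ε ^ 2 := hu.eventually_lt_const (by positivity)
  obtain ⟨N, hN1, hN2⟩ := (htail.and (eventually_forall_ge_atTop.2 hsmall)).exists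
  have htail' : ∀ m n, N ≤ m → ∑ j ∈ Finset.Ico m n, v j ≤ ε ^ 2 := by
    intro m n hm
    calc _ ≤ ∑ j ∈ Finset.Ico N n, v j :=
          Finset.sum_le_sum_of_subset_of_nonneg (Finset.Ico_subset_Ico_left hm)
            fun _ _ _ => hv0 _
      _ = ∑ i ∈ Finset.range (n - N), v (i + N) := by
          rw [Finset.sum_Ico_eq_sum_range]
          simp_rw [add_comm N]
      _ ≤ ∑' i, v (i + N) := Summable.sum_le_tsum _ (fun _ _ => hv0 _)
          ((summable_nat_add_iff N).2 (hsum ε hεpos))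
      _ ≤ _ := hN1.le
  obtain ⟨m₀, hm₀N, hm₀⟩ := (frequently_atTop.1 (hfreq ε hεpos)) N
  have claim : ∀ n, m₀ ≤ n → ∃ m, m₀ ≤ m ∧ m ≤ n ∧ ‖q m - x m‖ < ε ∧
      ‖q m - x n‖ ^ 2 ≤ 2 * ε ^ 2 + ∑ j ∈ Finset.Ico m n, v j := by
    intro n hn
    induction n, hn using Nat.le_induction with
    | base =>
      refine ⟨m₀, le_rfl, le_rfl, hm₀, ?_⟩
      have := pow_le_pow_left₀ (norm_nonneg _) hm₀.le 2
      simp only [Finset.Ico_self, Finset.sum_empty]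
      nlinarith
    | succ n hn ih =>
      rcases lt_or_ge ‖q n - x n‖ ε with hlt | hge
      · refine ⟨n, hn, by omega, hlt, ?_⟩
        have h1 := hanchor n n le_rfl
        have h2 := pow_le_pow_left₀ (norm_nonneg _) hlt.le 2
        have h3 := hN2 n (by omega)
        have h4 : 0 ≤ ∑ j ∈ Finset.Ico n (n + 1), v j := Finset.sum_nonneg fun _ _ => hv0 _
        linarith
      · obtain ⟨m, hm0, hmn, hm, hle⟩ := ih
        refine ⟨m, hm0, by omega, hm, ?_⟩
        have h1 := hanchor m n hmn
        have h2 : v n = u n := by simp [hv, hge]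
        rw [Finset.sum_Ico_succ_top hmn]
        linarith
  refine ⟨m₀, fun n hn => ?_⟩
  obtain ⟨m, hm0, -, hm, hle⟩ := claim n hn
  have h1 := htail' m n (by omega)
  have h2 : ‖q m - x n‖ ≤ 2 * ε := by
    refine le_of_sq_le_sq ?_ (by positivity)
    nlinarith
  have h3 : ‖x n - x m‖ ≤ 3 * ε := by
    have : x n - x m = (q m - x m) - (q m - x n) := by abel
    rw [this]
    exact (norm_sub_le _ _).trans (by linarith)
  have h4 := hL m n
  have h5 := mul_le_mul_of_nonneg_left h3 hL0
  have h6 : ε * (1 + 3 * L) < ε' := by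
    rw [hε]
    have : ε' / (2 * (1 + 3 * L)) * (1 + 3 * L) = ε' / 2 := by field_simp
    linarith
  rw [Real.dist_eq, sub_zero, abs_of_nonneg (norm_nonneg _)]
  linarith

/-! ### Almost sure consequences of summable localized expectations -/

theorem ae_tsum_ne_top_of_localized {Ω : Type*} [MeasurableSpace Ω] {μ : Measure Ω}
    {A : ℕ → Set Ω} (hA : ∀ n, MeasurableSet (A n)) {f : ℕ → Ω → ENNReal}
    (hf : ∀ n, Measurable (f n)) (hsum : ∑' n, ∫⁻ ω in A n, f n ω ∂μ ≠ ⊤) :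
    ∀ᵐ ω ∂μ, (∀ n, ω ∈ A n) → ∑' n, f n ω ≠ ⊤ := by
  have hm : ∀ n, Measurable ((A n).indicator (f n)) := fun n => (hf n).indicator (hA n)
  have h1 : ∫⁻ ω, ∑' n, (A n).indicator (f n) ω ∂μ ≠ ⊤ := by
    rw [lintegral_tsum fun n => (hm n).aemeasurable]
    simp_rw [lintegral_indicator (hA _)]
    exact hsum
  filter_upwards [ae_lt_top (Measurable.tsum hm) h1] with ω hω hmem
  have e : ∀ n, (A n).indicator (f n) ω = f n ω := fun n => Set.indicator_of_mem (hmem n) _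
  simp_rw [e] at hω
  exact hω.ne

theorem summable_of_tsum_ofReal_ne_top {f : ℕ → ℝ} (hf : ∀ n, 0 ≤ f n)
    (h : ∑' n, ENNReal.ofReal (f n) ≠ ⊤) : Summable f := by
  have := ENNReal.summable_toReal h
  simpa only [ENNReal.toReal_ofReal (hf _)] using this

theorem bddBelow_of_lsc_of_closed {d : ℕ} {X : Set (Vec d)} (hX : IsClosed X) {q : Vec d → ℝ}
    (hq : LowerSemicontinuousOn q X) (R : ℝ) : ∃ m, ∀ y ∈ X, ‖y‖ ≤ R → m ≤ q y := by
  have hc : IsCompact (X ∩ Metric.closedBall 0 R) := (isCompact_closedBall 0 R).inter_left hX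
  obtain ⟨m, hm⟩ :=
    (hq.mono (t := X ∩ Metric.closedBall 0 R) Set.inter_subset_left).bddBelow_of_isCompact hc
  exact ⟨m, fun y hy hyR => hm ⟨y, ⟨hy, by simpa using hyR⟩, rfl⟩⟩

namespace StoProblem

variable {d : ℕ} {S : Type*} [MeasurableSpace S] {P : Measure S}
  {X : Set (Vec d)} {F r φ : Vec d → ℝ} {ρ η lam : ℝ} {xstar : Vec d} {g : ℕ → Vec d → S → Vec d}
  {Ω : Type*} [mΩ : MeasurableSpace Ω] {μ : Measure Ω} {α : ℕ → ℝ}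
  {x0 : Vec d} {N : ℕ∞} {ℱ : Filtration ℕ mΩ} {ξ : ℕ → Ω → S} {x : ℕ → Ω → Vec d}

/-! ### Displacement of the iterates -/

theorem levelset_bounded (h : StoProblem P X F r φ ρ η lam xstar g) (hlb : LevelBoundedOn X φ)
    (M : ℝ) : ∃ R : ℝ, 0 ≤ R ∧ ∀ y, envGap X φ lam xstar y ≤ M →
      ‖proxMap X φ lam y‖ ≤ R ∧ ‖y‖ ≤ R ∧ φ (proxMap X φ lam y) ≤ M + φ xstar := by
  obtain ⟨R, hR⟩ := (hlb (M + φ xstar)).exists_norm_le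
  have hl := h.lam_pos
  refine ⟨|R| + √(2 * lam * M), by positivity, fun y hy => ?_⟩
  have h1 : φ (proxMap X φ lam y) ≤ M + φ xstar := by
    have h2 := h.envGap_eq y
    have h3 : 0 ≤ 1 / (2 * lam) * ‖proxMap X φ lam y - y‖ ^ 2 := by positivity
    linarith
  have h2 := (hR _ ⟨(h.proxRegular.prox_spec y).1, h1⟩).trans (le_abs_self R)
  have h3 : ‖proxMap X φ lam y - y‖ ≤ √(2 * lam * M) := by
    refine Real.le_sqrt_of_sq_le ((h.norm_prox_sub_sq_le y).trans ?_)
    gcongr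
  have h4 : ‖y‖ ≤ ‖proxMap X φ lam y‖ + ‖proxMap X φ lam y - y‖ := by
    have : y = proxMap X φ lam y - (proxMap X φ lam y - y) := by abel
    calc ‖y‖ = ‖proxMap X φ lam y - (proxMap X φ lam y - y)‖ := by rw [← this]
      _ ≤ _ := norm_sub_le _ _
  exact ⟨by linarith [Real.sqrt_nonneg (2 * lam * M)], by linarith, h1⟩

/-- `w k a x ξ` measures the displacement in one step: its second moment is of order `a²`, and on
each level set of the envelope the squared distance to any proximal point grows by at most a
multiple of `a + w`. -/
structure IsDisplacement (P : Measure S) (X : Set (Vec d)) (r φ : Vec d → ℝ) (η lam : ℝ)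
    (xstar : Vec d) (g : ℕ → Vec d → S → Vec d) (C : ℝ) (w : ℕ → ℝ → Vec d → S → ℝ) : Prop where
  const_nonneg : 0 ≤ C
  nonneg : ∀ k a x s, 0 < a → 0 ≤ w k a x s
  meas : ∀ k a, 0 < a → a * η ≤ 1 / 2 → Measurable (Function.uncurry (w k a))
  moment : ∀ k a, 0 < a → a * η ≤ 1 / 2 → ∀ x ∈ X,
    ∫⁻ s, ENNReal.ofReal (w k a x s ^ 2) ∂P ≤
      ENNReal.ofReal (a ^ 2 * (C * (envGap X φ lam xstar x + 1)))
  anchor : ∀ M : ℝ, ∃ B : ℝ, 0 ≤ B ∧ ∀ k a, 0 < a → a * η ≤ 1 / 2 → ∀ x ∈ X, ∀ s x' y,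
    IsProxStep X r a (g k x s) x x' → envGap X φ lam xstar x ≤ M → envGap X φ lam xstar x' ≤ M →
    envGap X φ lam xstar y ≤ M →
    ‖proxMap X φ lam y - x'‖ ^ 2 ≤ ‖proxMap X φ lam y - x‖ ^ 2 + B * (a + w k a x s)

/-- Under `(B'_{D-D})` the step length itself need not be of order `a`, as `r` may have unbounded
slope; but the squared distance to a proximal point, where `r` is bounded on level sets, grows by
`O(a (1 + ‖g‖))`. -/
theorem displacement_of_boundDD [IsProbabilityMeasure P]
    (h : StoProblem P X F r φ ρ η lam xstar g) (hlb : LevelBoundedOn X φ) (hb : BoundDD P X g) :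
    ∃ C w, IsDisplacement P X r φ η lam xstar g C w := by
  obtain ⟨M₀, hM₀, hmom⟩ := h.boundDD_moments hb
  refine ⟨M₀, fun k a x s => a * ‖g k x s‖, hM₀.le, fun k a x s ha => by positivity,
    fun k a _ _ => ((h.g_meas k).norm.const_mul a), fun k a ha _ x hx => ?_, fun M => ?_⟩
  · obtain ⟨-, hi, hle⟩ := hmom k x hx
    simp_rw [mul_pow]
    rw [← ofReal_integral_eq_lintegral_ofReal (hi.const_mul _) (ae_of_all _ fun s => by
      simp only [Pi.zero_apply]; positivity), integral_const_mul]
    have := h.envGap_nonneg x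
    refine ENNReal.ofReal_le_ofReal ?_
    gcongr
    nlinarith
  · obtain ⟨R, hR0, hR⟩ := h.levelset_bounded hlb M
    obtain ⟨mF, hmF⟩ := bddBelow_of_lsc_of_closed h.closed
      (lowerSemicontinuousOn_of_quadratic_support (h.support 0)) R
    obtain ⟨mr, hmr⟩ := bddBelow_of_lsc_of_closed h.closed h.r_lsc R
    have hη := h.eta_nonneg
    refine ⟨4 * η * R ^ 2 + 2 * |M + φ xstar - mF - mr| + 4 * R, by positivity, ?_⟩
    intro k a ha haη x hx s x' y hs hVx hVx' hVy
    obtain ⟨hz1, -, hz2⟩ := hR y hVy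
    obtain ⟨-, hx'R, -⟩ := hR x' hVx'
    have hzX := (h.proxRegular.prox_spec y).1
    set z := proxMap X φ lam y
    have h1 := hs.three_point h.r_wc ha hzX
    have h2 := hmF z hzX hz1
    have h3 := hmr x' hs.1 hx'R
    rw [h.eq_add] at hz2
    have h4 : r z - r x' ≤ |M + φ xstar - mF - mr| :=
      (by linarith : r z - r x' ≤ M + φ xstar - mF - mr).trans (le_abs_self _)
    have h5 : ‖z - x'‖ ≤ 2 * R := (norm_sub_le _ _).trans (by linarith)
    have h6 : ⟪g k x s, z - x'⟫ ≤ ‖g k x s‖ * (2 * R) :=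
      (real_inner_le_norm _ _).trans (by gcongr)
    have h7 : a * η * ‖z - x'‖ ^ 2 ≤ a * η * (2 * R) ^ 2 := by gcongr
    have h8 : 2 * a * (⟪g k x s, z - x'⟫ + r z - r x') ≤
        2 * a * (‖g k x s‖ * (2 * R) + |M + φ xstar - mF - mr|) := by
      refine mul_le_mul_of_nonneg_left ?_ (by positivity)
      linarith
    have h9 : 0 ≤ ‖x' - x‖ ^ 2 := sq_nonneg _
    have h10 : 0 ≤ a * ‖g k x s‖ * (4 * η * R ^ 2) := by positivity
    have h11 : 0 ≤ a * ‖g k x s‖ * (2 * |M + φ xstar - mF - mr|) := by positivity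
    have h12 : 0 ≤ a * (4 * R) := by positivity
    linarith

/-- Under `(B'_3)` the step length is of order `a`. -/
theorem displacement_of_boundThree [IsProbabilityMeasure P]
    (h : StoProblem P X F r φ ρ η lam xstar g) (hlb : LevelBoundedOn X φ)
    (hb : BoundThree P X η r φ (φ xstar) lam g) :
    ∃ C w, IsDisplacement P X r φ η lam xstar g C w := by
  obtain ⟨c₃, c₄, h3, h4, hb⟩ := hb
  refine ⟨4 * (c₃ + c₄), fun k a x s => ‖proxMap X r a (x - a • g k x s) - x‖, by positivity,
    fun k a x s ha => by positivity, fun k a ha haη => ?_, fun k a ha haη x hx => ?_, fun M => ?_⟩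
  · have hreg := h.proxRegular_r ha (by linarith)
    have hg : Measurable fun p : Vec d × S => g k p.1 p.2 := h.g_meas k
    exact ((hreg.continuous_prox.measurable.comp
      (measurable_fst.sub (hg.const_smul a))).sub measurable_fst).norm
  · have hreg := h.proxRegular_r ha (by linarith : a * η < 1)
    obtain ⟨v, hv, hi, hle⟩ := hb k x hx
    rw [show moreauEnv X φ lam x - φ xstar = envGap X φ lam xstar x from rfl] at hle
    have hpt : ∀ s, ‖proxMap X r a (x - a • g k x s) - x‖ ^ 2 ≤
        4 * a ^ 2 * ‖g k x s + v‖ ^ 2 := by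
      intro s
      have h1 := ((isProxStep_iff hreg (g k x s) x _).2 rfl).norm_sub_le h.r_wc ha (by linarith)
        hx hv
      have h2 : a * ‖g k x s + v‖ / (1 - a * η) ≤ 2 * (a * ‖g k x s + v‖) := by
        rw [div_le_iff₀ (by linarith)]
        have : 0 ≤ a * ‖g k x s + v‖ := by positivity
        nlinarith
      refine (pow_le_pow_left₀ (norm_nonneg _) (h1.trans h2) 2).trans (le_of_eq ?_)
      ring
    have hV := h.envGap_nonneg x
    calc _ ≤ ∫⁻ s, ENNReal.ofReal (4 * a ^ 2 * ‖g k x s + v‖ ^ 2) ∂P :=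
          lintegral_mono fun s => ENNReal.ofReal_le_ofReal (hpt s)
      _ = ENNReal.ofReal (4 * a ^ 2 * ∫ s, ‖g k x s + v‖ ^ 2 ∂P) := by
          rw [← integral_const_mul, ofReal_integral_eq_lintegral_ofReal (hi.const_mul _)
            (ae_of_all _ fun s => by simp only [Pi.zero_apply]; positivity)]
      _ ≤ _ := by
          refine ENNReal.ofReal_le_ofReal ?_
          have h5 : ∫ s, ‖g k x s + v‖ ^ 2 ∂P ≤ (c₃ + c₄) * (envGap X φ lam xstar x + 1) := by
            nlinarith [mul_nonneg h4 hV]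
          have := mul_le_mul_of_nonneg_left h5 (by positivity : 0 ≤ 4 * a ^ 2)
          linarith
  · obtain ⟨R, hR0, hR⟩ := h.levelset_bounded hlb M
    refine ⟨4 * R, by positivity, ?_⟩
    intro k a ha haη x hx s x' y hs hVx hVx' hVy
    obtain ⟨hz1, -, -⟩ := hR y hVy
    obtain ⟨-, hx'R, -⟩ := hR x' hVx'
    obtain ⟨-, hxR, -⟩ := hR x hVx
    rw [← (isProxStep_iff (h.proxRegular_r ha (by linarith : a * η < 1)) _ _ _).1 hs]
    set z := proxMap X φ lam y
    have h5 : ‖z - x'‖ ≤ 2 * R := (norm_sub_le _ _).trans (by linarith)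
    have h6 : ‖z - x‖ ≤ 2 * R := (norm_sub_le _ _).trans (by linarith)
    have h7 : ‖z - x'‖ - ‖z - x‖ ≤ ‖x' - x‖ := by
      have := norm_sub_norm_le (z - x') (z - x)
      rwa [sub_sub_sub_cancel_left, norm_sub_rev x] at this
    have h8 : ‖z - x'‖ ^ 2 - ‖z - x‖ ^ 2 ≤ (‖z - x'‖ + ‖z - x‖) * ‖x' - x‖ := by
      have := mul_le_mul_of_nonneg_left h7 (by positivity : 0 ≤ ‖z - x'‖ + ‖z - x‖)
      linarith
    have h9 : (‖z - x'‖ + ‖z - x‖) * ‖x' - x‖ ≤ 4 * R * ‖x' - x‖ := by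
      gcongr
      linarith
    have h10 : 0 ≤ 4 * R * a := by positivity
    linarith

end StoProblem

namespace StoProblem

variable {d : ℕ} {S : Type*} [MeasurableSpace S] {P : Measure S}
  {X : Set (Vec d)} {F r φ : Vec d → ℝ} {ρ η lam : ℝ} {xstar : Vec d} {g : ℕ → Vec d → S → Vec d}
  {Ω : Type*} [mΩ : MeasurableSpace Ω] {μ : Measure Ω} {α : ℕ → ℝ}
  {x0 : Vec d} {N : ℕ∞} {ℱ : Filtration ℕ mΩ} {ξ : ℕ → Ω → S} {x : ℕ → Ω → Vec d}

/-! ### Localization to runs that stay in a level set -/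

/-- The event that the envelope gap is at most `M₀` at time `K` and at most `M` at the times
`K, …, K + n`. -/
def staysBelow (X : Set (Vec d)) (φ : Vec d → ℝ) (lam : ℝ) (xstar : Vec d)
    (x : ℕ → Ω → Vec d) (K : ℕ) (M₀ M : ℝ) (n : ℕ) : Set Ω :=
  {ω | envGap X φ lam xstar (x K ω) ≤ M₀ ∧
    ∀ j ≤ n, envGap X φ lam xstar (x (K + j) ω) ≤ M}

theorem measurableSet_staysBelow (h : StoProblem P X F r φ ρ η lam xstar g)
    (hr : IsStoSubGradRun μ P X r g α x0 ⊤ ℱ ξ x) (K : ℕ) (M₀ M : ℝ) (n : ℕ) :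
    MeasurableSet[ℱ (K + n)] (staysBelow X φ lam xstar x K M₀ M n) := by
  have hVm := h.continuous_envGap.measurable
  have hlev : ∀ j ≤ n, ∀ c : ℝ,
      MeasurableSet[ℱ (K + n)] {ω | envGap X φ lam xstar (x (K + j) ω) ≤ c} := by
    intro j hj c
    have hx : Measurable[ℱ (K + n)] (x (K + j)) :=
      (hr.iterate_measurable (K + j) le_top).mono (ℱ.mono (by omega)) le_rfl
    exact (hVm.comp hx) measurableSet_Iic
  have e : staysBelow X φ lam xstar x K M₀ M n = {ω | envGap X φ lam xstar (x (K + 0) ω) ≤ M₀} ∩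
      ⋂ j ∈ Finset.range (n + 1), {ω | envGap X φ lam xstar (x (K + j) ω) ≤ M} := by
    ext ω
    simp [staysBelow]
  rw [e]
  exact (hlev 0 (by omega) M₀).inter (Finset.measurableSet_biInter _ fun j hj =>
    hlev j (by simpa [Nat.lt_succ_iff] using hj) M)

theorem staysBelow_succ_subset {Ω : Type*} {x : ℕ → Ω → Vec d} (K : ℕ) (M₀ M : ℝ) (n : ℕ) :
    staysBelow X φ lam xstar x K M₀ M (n + 1) ⊆ staysBelow X φ lam xstar x K M₀ M n :=
  fun _ hω => ⟨hω.1, fun j hj => hω.2 j (by omega)⟩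

/-- The localized expectations of the squared gradients, and `M` times the probability of leaving
the level set `{gap ≤ M}`, have a sum that does not depend on `M`. This plays the part of the
supermartingale convergence theorem. -/
theorem tsum_localized_le [IsProbabilityMeasure P] [IsProbabilityMeasure μ]
    (h : StoProblem P X F r φ ρ η lam xstar g) {C : ℝ} (hC : 0 < C)
    (hd : DescentWith P X r φ ρ η lam xstar g C)
    (hr : IsStoSubGradRun μ P X r g α x0 ⊤ ℱ ξ x) (hx0 : x0 ∈ X) (hα : ∀ k, 0 < α k)
    (hα2 : Summable fun k => α k ^ 2) {K : ℕ}
    (had : ∀ k, K ≤ k → AdmissibleStep P X ρ η r φ (φ xstar) lam g (α k)) (M₀ M : ℝ) :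
    ∑' n, (ENNReal.ofReal M * μ (staysBelow X φ lam xstar x K M₀ M n \
          staysBelow X φ lam xstar x K M₀ M (n + 1))
        + ∫⁻ ω in staysBelow X φ lam xstar x K M₀ M n, ENNReal.ofReal (descentCoeff ρ η lam *
          α (K + n) * ‖∇ (moreauEnv X φ lam) (x (K + n) ω)‖ ^ 2) ∂μ) ≤
      ENNReal.ofReal (Real.exp (C * ∑' n, α (K + n) ^ 2)) * ENNReal.ofReal (M₀ + 1) := by
  set V := envGap X φ lam xstar
  set A := staysBelow X φ lam xstar x K M₀ M with hAdef
  have hAm : ∀ n, MeasurableSet[ℱ (K + n)] (A n) := h.measurableSet_staysBelow hr K M₀ M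
  have hAm' : ∀ n, MeasurableSet (A n) := fun n => ℱ.le _ _ (hAm n)
  set a : ℕ → ENNReal := fun n => ∫⁻ ω in A n, ENNReal.ofReal (V (x (K + n) ω) + 1) ∂μ with ha
  set b : ℕ → ENNReal := fun n => ENNReal.ofReal M * μ (A n \ A (n + 1))
    + ∫⁻ ω in A n, ENNReal.ofReal (descentCoeff ρ η lam *
          α (K + n) * ‖∇ (moreauEnv X φ lam) (x (K + n) ω)‖ ^ 2) ∂μ with hb
  have ha0 : a 0 ≤ ENNReal.ofReal (M₀ + 1) := by
    calc a 0 ≤ ∫⁻ _ in A 0, ENNReal.ofReal (M₀ + 1) ∂μ := by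
          refine setLIntegral_mono' (hAm' 0) fun ω hω => ENNReal.ofReal_le_ofReal ?_
          have : V (x K ω) ≤ M₀ := hω.1
          simp only [add_zero]
          linarith
      _ = ENNReal.ofReal (M₀ + 1) * μ (A 0) := by simp
      _ ≤ ENNReal.ofReal (M₀ + 1) * 1 := by
          gcongr
          exact prob_le_one
      _ = _ := mul_one _
  have hrec : ∀ n, a (n + 1) + b n ≤ ENNReal.ofReal (1 + C * α (K + n) ^ 2) * a n := by
    intro n
    have h1 := h.setLIntegral_descent hC hd hr hx0 (ENat.natCast_lt_top (K + n)) (hα _)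
      (had (K + n) (by omega)) (hAm n)
    refine le_trans ?_ h1
    simp only [ha, hb]
    rw [← add_assoc]
    gcongr
    rw [← lintegral_inter_add_sdiff _ (A n) (hAm' (n + 1)),
      Set.inter_eq_self_of_subset_right (staysBelow_succ_subset K M₀ M n)]
    gcongr ?_ + ?_
    · exact le_rfl
    · rw [← setLIntegral_const]
      refine setLIntegral_mono' ((hAm' n).diff (hAm' (n + 1))) fun ω hω => ?_
      refine ENNReal.ofReal_le_ofReal ?_
      by_contra! hlt
      refine hω.2 ⟨hω.1.1, fun j hj => ?_⟩
      rcases Nat.lt_or_eq_of_le hj with hj' | rfl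
      · exact hω.1.2 j (by omega)
      · have : V (x (K + n + 1) ω) + 1 < M := hlt
        have : V (x (K + n + 1) ω) ≤ M := by linarith
        exact this
  have hα2' : Summable fun n => α (K + n) ^ 2 := by
    simpa only [add_comm K] using (summable_nat_add_iff K).2 hα2
  refine ENNReal.tsum_le_of_sum_range_le fun n => ?_
  have h1 := gronwall_add_sum_le (a := a) (b := b) (β := fun n => C * α (K + n) ^ 2)
    (fun k => by positivity) (n := n) fun j _ => hrec j
  refine (le_add_self.trans h1).trans ?_
  rw [← Finset.mul_sum]
  gcongr
  exact Summable.sum_le_tsum _ (fun _ _ => sq_nonneg _) hα2'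

/-- Almost every run with bounded gap at time `K` stays in some level set afterwards. -/
theorem ae_exists_staysBelow [IsProbabilityMeasure P] [IsProbabilityMeasure μ]
    (h : StoProblem P X F r φ ρ η lam xstar g) {C : ℝ} (hC : 0 < C)
    (hd : DescentWith P X r φ ρ η lam xstar g C)
    (hr : IsStoSubGradRun μ P X r g α x0 ⊤ ℱ ξ x) (hx0 : x0 ∈ X) (hα : ∀ k, 0 < α k)
    (hα2 : Summable fun k => α k ^ 2) {K : ℕ}
    (had : ∀ k, K ≤ k → AdmissibleStep P X ρ η r φ (φ xstar) lam g (α k)) (M₀ : ℕ) :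
    ∀ᵐ ω ∂μ, envGap X φ lam xstar (x K ω) ≤ M₀ →
      ∃ M : ℕ, ∀ n, ω ∈ staysBelow X φ lam xstar x K M₀ M n := by
  set H : ENNReal := ENNReal.ofReal (Real.exp (C * ∑' n, α (K + n) ^ 2)) *
    ENNReal.ofReal (M₀ + 1)
  have hH : H ≠ ⊤ := ENNReal.mul_ne_top ENNReal.ofReal_ne_top ENNReal.ofReal_ne_top
  set bad : Set Ω := {ω | envGap X φ lam xstar (x K ω) ≤ M₀ ∧
      ∀ M : ℕ, ∃ n, ω ∉ staysBelow X φ lam xstar x K M₀ M n} with hbad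
  have hle : ∀ M : ℕ, M₀ ≤ M → (M : ENNReal) * μ bad ≤ H := by
    intro M hM
    set A := staysBelow X φ lam xstar x K M₀ M
    have hsub : bad ⊆ ⋃ n, A n \ A (n + 1) := by
      rintro ω ⟨hω, hω'⟩
      have hex := hω' M
      classical
      have hfind := Nat.find_spec hex
      have h0 : ω ∈ A 0 := by
        refine ⟨hω, fun j hj => ?_⟩
        obtain rfl : j = 0 := by omega
        exact le_trans hω (by exact_mod_cast hM)
      have hpos : Nat.find hex ≠ 0 := fun h0' => hfind (h0' ▸ h0)
      obtain ⟨m, hm⟩ := Nat.exists_eq_succ_of_ne_zero hpos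
      refine Set.mem_iUnion.2 ⟨m, ?_, ?_⟩
      · exact not_not.1 (Nat.find_min hex (m := m) (by omega))
      · rw [hm] at hfind
        exact hfind
    calc (M : ENNReal) * μ bad ≤ M * ∑' n, μ (A n \ A (n + 1)) := by
          gcongr
          exact (measure_mono hsub).trans (measure_iUnion_le _)
      _ = ∑' n, ENNReal.ofReal (M : ℝ) * μ (A n \ A (n + 1)) := by
          rw [ENNReal.tsum_mul_left, ENNReal.ofReal_natCast]
      _ ≤ _ := ENNReal.tsum_le_tsum fun n => le_self_add
      _ ≤ H := h.tsum_localized_le hC hd hr hx0 hα hα2 had M₀ M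
  have hzero : μ bad = 0 := by
    by_contra hne
    have hlim : Tendsto (fun M : ℕ => (M : ENNReal) * μ bad) atTop (𝓝 (⊤ * μ bad)) :=
      ENNReal.Tendsto.mul_const ENNReal.tendsto_nat_nhds_top (Or.inl ENNReal.top_ne_zero)
    have := le_of_tendsto hlim (eventually_atTop.2 ⟨M₀, hle⟩)
    rw [ENNReal.top_mul hne] at this
    exact hH (top_le_iff.1 this)
  have hae : ∀ᵐ ω ∂μ, ω ∉ bad := measure_eq_zero_iff_ae_notMem.1 hzero
  filter_upwards [hae] with ω hω hK
  by_contra! hcon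
  exact hω ⟨hK, hcon⟩

end StoProblem

namespace StoProblem

variable {d : ℕ} {S : Type*} [MeasurableSpace S] {P : Measure S}
  {X : Set (Vec d)} {F r φ : Vec d → ℝ} {ρ η lam : ℝ} {xstar : Vec d} {g : ℕ → Vec d → S → Vec d}
  {Ω : Type*} [mΩ : MeasurableSpace Ω] {μ : Measure Ω} {α : ℕ → ℝ}
  {x0 : Vec d} {N : ℕ∞} {ℱ : Filtration ℕ mΩ} {ξ : ℕ → Ω → S} {x : ℕ → Ω → Vec d}

/-! ### Almost sure convergence -/

/-- Away from the stationary points the mean displacement is dominated by the descent. -/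
theorem lintegral_displacement_le [IsProbabilityMeasure P]
    (h : StoProblem P X F r φ ρ η lam xstar g) {C : ℝ}
    {w : ℕ → ℝ → Vec d → S → ℝ} (hw : IsDisplacement P X r φ η lam xstar g C w) {ε M : ℝ}
    (hε : 0 < ε) {k : ℕ} {a : ℝ} (ha : 0 < a) (haη : a * η ≤ 1 / 2) {x : Vec d} (hx : x ∈ X)
    (hxM : envGap X φ lam xstar x ≤ M) :
    ∫⁻ s, ENNReal.ofReal (if ε ≤ ‖proxMap X φ lam x - x‖ then a + w k a x s else 0) ∂P ≤
      ENNReal.ofReal ((2 + C * (M + 1)) * lam ^ 2 / (ε ^ 2 * descentCoeff ρ η lam)) *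
        ENNReal.ofReal (descentCoeff ρ η lam * a * ‖∇ (moreauEnv X φ lam) x‖ ^ 2) := by
  split_ifs with hδ
  swap
  · simp
  have hc := h.descentCoeff_pos
  have hC := hw.const_nonneg
  have hl := h.lam_pos
  have hV := h.envGap_nonneg x
  have hM : 0 ≤ M := hV.trans hxM
  -- Only the second moment of `w` is at hand, and `w ≤ a + w² / a`.
  have hpt : ∀ s, a + w k a x s ≤ 2 * a + a⁻¹ * w k a x s ^ 2 := by
    intro s
    have h1 := hw.nonneg k a x s ha
    have h2 : a * w k a x s ≤ a * (a + a⁻¹ * w k a x s ^ 2) := by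
      rw [mul_add, mul_inv_cancel_left₀ ha.ne']
      nlinarith [sq_nonneg (a - w k a x s)]
    linarith [le_of_mul_le_mul_left h2 ha]
  calc _ ≤ ∫⁻ s, (ENNReal.ofReal (2 * a)
          + ENNReal.ofReal a⁻¹ * ENNReal.ofReal (w k a x s ^ 2)) ∂P := by
        refine lintegral_mono fun s => ?_
        rw [← ENNReal.ofReal_mul (by positivity), ← ENNReal.ofReal_add (by positivity)
          (by positivity)]
        exact ENNReal.ofReal_le_ofReal (hpt s)
    _ = ENNReal.ofReal (2 * a)
          + ENNReal.ofReal a⁻¹ * ∫⁻ s, ENNReal.ofReal (w k a x s ^ 2) ∂P := by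
        rw [lintegral_add_left measurable_const, lintegral_const_mul' _ _ ENNReal.ofReal_ne_top]
        simp
    _ ≤ ENNReal.ofReal (2 * a) + ENNReal.ofReal a⁻¹ *
          ENNReal.ofReal (a ^ 2 * (C * (envGap X φ lam xstar x + 1))) := by
        gcongr
        exact hw.moment k a ha haη x hx
    _ = ENNReal.ofReal (a * (2 + C * (envGap X φ lam xstar x + 1))) := by
        rw [← ENNReal.ofReal_mul (by positivity), ← ENNReal.ofReal_add (by positivity)
          (by positivity)]
        congr 1
        field_simp
    _ ≤ _ := by
        rw [← ENNReal.ofReal_mul (by positivity), h.norm_gradient_sq]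
        refine ENNReal.ofReal_le_ofReal ?_
        have e : (2 + C * (M + 1)) * lam ^ 2 / (ε ^ 2 * descentCoeff ρ η lam) *
            (descentCoeff ρ η lam * a * ((1 / lam) ^ 2 * ‖proxMap X φ lam x - x‖ ^ 2)) =
            a * (2 + C * (M + 1)) * (‖proxMap X φ lam x - x‖ / ε) ^ 2 := by
          field_simp
        rw [e]
        have h1 : 1 ≤ (‖proxMap X φ lam x - x‖ / ε) ^ 2 :=
          one_le_pow₀ ((one_le_div hε).2 hδ)
        calc a * (2 + C * (envGap X φ lam xstar x + 1)) ≤ a * (2 + C * (M + 1)) * 1 := by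
              rw [mul_one]
              gcongr
          _ ≤ _ := by gcongr

theorem ae_tsum_sample_ne_top [IsProbabilityMeasure P] [IsProbabilityMeasure μ]
    (hr : IsStoSubGradRun μ P X r g α x0 ⊤ ℱ ξ x) {K : ℕ} {A : ℕ → Set Ω}
    (hA : ∀ n, MeasurableSet[ℱ (K + n)] (A n)) {ψ : ℕ → Vec d × S → ENNReal}
    (hψ : ∀ n, Measurable (ψ n)) {b : ℕ → Ω → ENNReal}
    (hle : ∀ n, ∀ ω ∈ A n, ∫⁻ s, ψ n (x (K + n) ω, s) ∂P ≤ b n ω)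
    (hb : ∑' n, ∫⁻ ω in A n, b n ω ∂μ ≠ ⊤) :
    ∀ᵐ ω ∂μ, (∀ n, ω ∈ A n) → ∑' n, ψ n (x (K + n) ω, ξ (K + n) ω) ≠ ⊤ := by
  have hA' : ∀ n, MeasurableSet (A n) := fun n => ℱ.le _ _ (hA n)
  have hξm : ∀ k, Measurable (ξ k) := fun k =>
    (hr.sample_measurable k (ENat.natCast_lt_top k)).mono (ℱ.le _) le_rfl
  refine ae_tsum_ne_top_of_localized hA' (fun n => (hψ n).comp
    ((hr.measurable_iterate le_top).prodMk (hξm (K + n)))) ?_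
  refine ne_top_of_le_ne_top hb (ENNReal.tsum_le_tsum fun n => ?_)
  exact (hr.setLIntegral_sample (ENat.natCast_lt_top (K + n)) (hA n) (hψ n)).le.trans
    (setLIntegral_mono' (hA' n) (hle n))

section Localized

variable [IsProbabilityMeasure P] [IsProbabilityMeasure μ]

theorem tsum_localized_gradient_ne_top
    (h : StoProblem P X F r φ ρ η lam xstar g) {C : ℝ} (hC : 0 < C)
    (hd : DescentWith P X r φ ρ η lam xstar g C)
    (hr : IsStoSubGradRun μ P X r g α x0 ⊤ ℱ ξ x) (hx0 : x0 ∈ X) (hα : ∀ k, 0 < α k)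
    (hα2 : Summable fun k => α k ^ 2) {K : ℕ}
    (had : ∀ k, K ≤ k → AdmissibleStep P X ρ η r φ (φ xstar) lam g (α k)) (M₀ M : ℝ) :
    ∑' n, ∫⁻ ω in staysBelow X φ lam xstar x K M₀ M n, ENNReal.ofReal (descentCoeff ρ η lam *
      α (K + n) * ‖∇ (moreauEnv X φ lam) (x (K + n) ω)‖ ^ 2) ∂μ ≠ ⊤ :=
  ne_top_of_le_ne_top (ENNReal.mul_ne_top ENNReal.ofReal_ne_top ENNReal.ofReal_ne_top)
    ((ENNReal.tsum_le_tsum fun _ => le_add_self).trans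
      (h.tsum_localized_le hC hd hr hx0 hα hα2 had M₀ M))

theorem ae_summable_gradient
    (h : StoProblem P X F r φ ρ η lam xstar g) {C : ℝ} (hC : 0 < C)
    (hd : DescentWith P X r φ ρ η lam xstar g C)
    (hr : IsStoSubGradRun μ P X r g α x0 ⊤ ℱ ξ x) (hx0 : x0 ∈ X) (hα : ∀ k, 0 < α k)
    (hα2 : Summable fun k => α k ^ 2) {K : ℕ}
    (had : ∀ k, K ≤ k → AdmissibleStep P X ρ η r φ (φ xstar) lam g (α k)) (M₀ M : ℝ) :
    ∀ᵐ ω ∂μ, (∀ n, ω ∈ staysBelow X φ lam xstar x K M₀ M n) →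
      Summable fun n => α (K + n) * ‖∇ (moreauEnv X φ lam) (x (K + n) ω)‖ ^ 2 := by
  have hc := h.descentCoeff_pos
  have ae1 := ae_tsum_ne_top_of_localized
    (fun n => ℱ.le _ _ (h.measurableSet_staysBelow hr K M₀ M n)) (fun n =>
    (((h.continuous_norm_gradient.measurable.comp
      (hr.measurable_iterate (k := K + n) le_top)).pow_const 2).const_mul
      (descentCoeff ρ η lam * α (K + n))).ennreal_ofReal)
    (h.tsum_localized_gradient_ne_top hC hd hr hx0 hα hα2 had M₀ M)
  filter_upwards [ae1] with ω h1 hω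
  have h4 := summable_of_tsum_ofReal_ne_top
    (fun n => by have := hα (K + n); simp only [Function.comp_apply]; positivity) (h1 hω)
  refine (h4.mul_left (descentCoeff ρ η lam)⁻¹).congr fun n => ?_
  simp only [Function.comp_apply]
  field_simp

theorem ae_summable_displacement_sq
    (h : StoProblem P X F r φ ρ η lam xstar g) {C' : ℝ}
    {w : ℕ → ℝ → Vec d → S → ℝ} (hw : IsDisplacement P X r φ η lam xstar g C' w)
    (hr : IsStoSubGradRun μ P X r g α x0 ⊤ ℱ ξ x) (hx0 : x0 ∈ X) (hα : ∀ k, 0 < α k)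
    (hα2 : Summable fun k => α k ^ 2) {K : ℕ} (hαη : ∀ k, K ≤ k → α k * η ≤ 1 / 2) (M₀ M : ℝ) :
    ∀ᵐ ω ∂μ, (∀ n, ω ∈ staysBelow X φ lam xstar x K M₀ M n) →
      Summable fun n => w (K + n) (α (K + n)) (x (K + n) ω) (ξ (K + n) ω) ^ 2 := by
  have hC' := hw.const_nonneg
  have hα2' : Summable fun n => α (K + n) ^ 2 * (C' * (M + 1)) := by
    have := (summable_nat_add_iff K).2 hα2
    simp_rw [add_comm _ K] at this
    exact this.mul_right _
  have hwm : ∀ n, Measurable fun p : Vec d × S => w (K + n) (α (K + n)) p.1 p.2 := fun n =>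
    hw.meas (K + n) (α (K + n)) (hα _) (hαη _ (by omega))
  have ae2 := ae_tsum_sample_ne_top hr (h.measurableSet_staysBelow hr K M₀ M)
    (ψ := fun n p => ENNReal.ofReal (w (K + n) (α (K + n)) p.1 p.2 ^ 2))
    (b := fun n _ => ENNReal.ofReal (α (K + n) ^ 2 * (C' * (M + 1))))
    (fun n => ((hwm n).pow_const 2).ennreal_ofReal) (fun n ω hω => ?_) ?_
  · filter_upwards [ae2] with ω h2 hω
    exact summable_of_tsum_ofReal_ne_top (fun n => sq_nonneg _) (h2 hω)
  · refine (hw.moment _ _ (hα _) (hαη _ (by omega)) _ (hr.mem hx0 le_top ω)).trans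
      (ENNReal.ofReal_le_ofReal ?_)
    have := hω.2 n le_rfl
    gcongr
  · refine ne_top_of_le_ne_top hα2'.tsum_ofReal_ne_top (ENNReal.tsum_le_tsum fun n => ?_)
    rw [setLIntegral_const]
    exact mul_le_of_le_one_right' prob_le_one

theorem ae_summable_displacement
    (h : StoProblem P X F r φ ρ η lam xstar g) {C : ℝ} (hC : 0 < C)
    (hd : DescentWith P X r φ ρ η lam xstar g C) {C' : ℝ}
    {w : ℕ → ℝ → Vec d → S → ℝ} (hw : IsDisplacement P X r φ η lam xstar g C' w)
    (hr : IsStoSubGradRun μ P X r g α x0 ⊤ ℱ ξ x) (hx0 : x0 ∈ X) (hα : ∀ k, 0 < α k)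
    (hα2 : Summable fun k => α k ^ 2) {K : ℕ}
    (had : ∀ k, K ≤ k → AdmissibleStep P X ρ η r φ (φ xstar) lam g (α k))
    (hαη : ∀ k, K ≤ k → α k * η ≤ 1 / 2) (M₀ M : ℝ) {ε : ℝ} (hε : 0 < ε) :
    ∀ᵐ ω ∂μ, (∀ n, ω ∈ staysBelow X φ lam xstar x K M₀ M n) →
      Summable fun n => if ε ≤ ‖proxMap X φ lam (x (K + n) ω) - x (K + n) ω‖ then
        α (K + n) + w (K + n) (α (K + n)) (x (K + n) ω) (ξ (K + n) ω) else 0 := by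
  have hδm : Measurable fun y => ‖proxMap X φ lam y - y‖ :=
    (h.proxRegular.continuous_prox.sub continuous_id).norm.measurable
  have hwm : ∀ n, Measurable fun p : Vec d × S => w (K + n) (α (K + n)) p.1 p.2 := fun n =>
    hw.meas (K + n) (α (K + n)) (hα _) (hαη _ (by omega))
  have hψ : ∀ n, Measurable fun p : Vec d × S => ENNReal.ofReal
      (if ε ≤ ‖proxMap X φ lam p.1 - p.1‖ then
        α (K + n) + w (K + n) (α (K + n)) p.1 p.2 else 0) := fun n =>
    (Measurable.ite (measurableSet_le measurable_const (hδm.comp measurable_fst))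
      ((hwm n).const_add _) measurable_const).ennreal_ofReal
  have ae3 := ae_tsum_sample_ne_top hr (h.measurableSet_staysBelow hr K M₀ M) hψ
    (fun n ω hω => h.lintegral_displacement_le hw hε (hα _) (hαη _ (by omega))
      (hr.mem hx0 le_top ω) (hω.2 n le_rfl)) ?_
  · filter_upwards [ae3] with ω h3 hω
    refine summable_of_tsum_ofReal_ne_top (fun n => ?_) (h3 hω)
    have := hw.nonneg (K + n) (α (K + n)) (x (K + n) ω) (ξ (K + n) ω) (hα _)
    have := hα (K + n)
    split_ifs <;> positivity
  · simp_rw [lintegral_const_mul' _ _ ENNReal.ofReal_ne_top]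
    rw [ENNReal.tsum_mul_left]
    exact ENNReal.mul_ne_top ENNReal.ofReal_ne_top
      (h.tsum_localized_gradient_ne_top hC hd hr hx0 hα hα2 had M₀ M)

end Localized

/-- On a run that stays in a level set, summable localized displacements force the distances to
the proximal points to vanish. -/
theorem tendsto_norm_prox_sub (h : StoProblem P X F r φ ρ η lam xstar g) {C' : ℝ}
    {w : ℕ → ℝ → Vec d → S → ℝ} (hw : IsDisplacement P X r φ η lam xstar g C' w)
    (hr : IsStoSubGradRun μ P X r g α x0 ⊤ ℱ ξ x) (hx0 : x0 ∈ X) (hα : IsSigmaSequence α) {K : ℕ}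
    (hαη : ∀ k, K ≤ k → α k * η ≤ 1 / 2) {M : ℝ} {ω : Ω}
    (hM : ∀ n, envGap X φ lam xstar (x (K + n) ω) ≤ M)
    (hG : Summable fun n => α (K + n) * ‖∇ (moreauEnv X φ lam) (x (K + n) ω)‖ ^ 2)
    (hw2 : Summable fun n => w (K + n) (α (K + n)) (x (K + n) ω) (ξ (K + n) ω) ^ 2)
    (hdisp : ∀ i : ℕ, Summable fun n => if 1 / ((i : ℝ) + 1) ≤
        ‖proxMap X φ lam (x (K + n) ω) - x (K + n) ω‖ then
      α (K + n) + w (K + n) (α (K + n)) (x (K + n) ω) (ξ (K + n) ω) else 0) :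
    Tendsto (fun k => ‖proxMap X φ lam (x k ω) - x k ω‖) atTop (𝓝 0) := by
  obtain ⟨B, hB, hanchor⟩ := hw.anchor M
  have hl := h.lam_pos
  set p := proxMap X φ lam
  set W : ℕ → ℝ := fun n => w (K + n) (α (K + n)) (x (K + n) ω) (ξ (K + n) ω)
  have hW0 : ∀ n, 0 ≤ W n := fun n => hw.nonneg _ _ _ _ (hα.pos _)
  have hα0 : ∀ n, 0 < α (K + n) := fun n => hα.pos _
  have hsqrt : ∀ {v : ℕ → ℝ}, (∀ n, 0 ≤ v n) → (Summable fun n => v n ^ 2) →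
      Tendsto v atTop (𝓝 0) := by
    intro v hv hs
    have h1 := hs.tendsto_atTop_zero.sqrt
    simpa only [Real.sqrt_sq (hv _), Real.sqrt_zero] using h1
  have hαlim : Tendsto (fun n => α (K + n)) atTop (𝓝 0) := by
    have := (tendsto_add_atTop_iff_nat K).2 (hsqrt (fun n => (hα.pos n).le) hα.summable_sq)
    simpa only [add_comm K] using this
  have hfreq : ∀ ε : ℝ, 0 < ε → ∃ᶠ n in atTop, ‖p (x (K + n) ω) - x (K + n) ω‖ < ε := by
    intro ε hε hcon
    have hsum : Summable fun n => α (K + n) := by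
      refine (hG.mul_left (lam ^ 2 / ε ^ 2)).of_norm_bounded_eventually_nat ?_
      filter_upwards [hcon] with n hn
      rw [Real.norm_eq_abs, abs_of_pos (hα0 n), h.norm_gradient_sq]
      have h1 : 1 ≤ (‖p (x (K + n) ω) - x (K + n) ω‖ / ε) ^ 2 :=
        one_le_pow₀ ((one_le_div hε).2 (not_lt.1 hn))
      have e : lam ^ 2 / ε ^ 2 * (α (K + n) * ((1 / lam) ^ 2 *
          ‖p (x (K + n) ω) - x (K + n) ω‖ ^ 2)) =
          α (K + n) * (‖p (x (K + n) ω) - x (K + n) ω‖ / ε) ^ 2 := by field_simp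
      rw [e]
      exact le_mul_of_one_le_right (hα0 n).le h1
    simp_rw [add_comm K] at hsum
    exact hα.not_summable ((summable_nat_add_iff K).1 hsum)
  have hLpos : 0 < 1 / (1 - lam * (ρ + η)) :=
    one_div_pos.2 (by linarith [h.proxRegular.lam_lt])
  have key := tendsto_norm_sub_zero_of_anchored (q := fun n => p (x (K + n) ω))
    (x := fun n => x (K + n) ω) (u := fun n => B * (α (K + n) + W n))
    (L := 1 / (1 - lam * (ρ + η)) + 1) (fun n => by have := hW0 n; have := hα0 n; positivity)
    (by simpa using (hαlim.add (hsqrt hW0 hw2)).const_mul B) (by positivity) ?_ ?_ ?_ hfreq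
  · refine (tendsto_add_atTop_iff_nat (f := fun k => ‖p (x k ω) - x k ω‖) K).1 ?_
    simpa only [add_comm K] using key
  · intro m n
    have h1 := h.proxRegular.prox_lipschitz (x (K + n) ω) (x (K + m) ω)
    have e : p (x (K + n) ω) - x (K + n) ω = (p (x (K + m) ω) - x (K + m) ω)
        + ((p (x (K + n) ω) - p (x (K + m) ω)) - (x (K + n) ω - x (K + m) ω)) := by abel
    rw [e]
    refine (norm_add_le _ _).trans ?_
    gcongr
    refine (norm_sub_le _ _).trans ?_
    rw [add_mul, one_mul]
    gcongr
  · intro m j _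
    exact hanchor (K + j) (α (K + j)) (hα0 j) (hαη _ (by omega)) _ (hr.mem hx0 le_top ω) _ _ _
      (hr.step (K + j) (ENat.natCast_lt_top _) ω) (hM j) (hM (j + 1)) (hM m)
  · intro ε hε
    obtain ⟨i, hi⟩ := exists_nat_one_div_lt hε
    refine Summable.of_nonneg_of_le (fun n => ?_) (fun n => ?_) ((hdisp i).mul_left B)
    · have := hW0 n
      have := hα0 n
      split_ifs <;> positivity
    · have h1 := hW0 n
      have h2 := hα0 n
      by_cases hn : ε ≤ ‖p (x (K + n) ω) - x (K + n) ω‖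
      · rw [if_pos hn, if_pos (hi.le.trans hn)]
      · rw [if_neg hn]
        refine mul_nonneg hB ?_
        split_ifs
        exacts [by positivity, le_rfl]

/-- Fixed points of the proximal map are critical points. -/
theorem isCriticalOn_of_prox_eq (h : StoProblem P X F r φ ρ η lam xstar g) {z : Vec d}
    (hz : proxMap X φ lam z = z) : IsCriticalOn X (ρ + η) φ z := by
  have hzX : z ∈ X := hz ▸ (h.proxRegular.prox_spec z).1
  refine ⟨hzX, 0, mem_weakSubdiff_iff.2 fun y hy => ?_, 0, fun y _ => by simp, by simp⟩
  have h1 := h.proxRegular.growth z hy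
  rw [hz, sub_self, norm_zero] at h1
  have e : 1 / (2 * lam) * ‖y - z‖ ^ 2 = 1 / lam / 2 * ‖y - z‖ ^ 2 := by
    have := h.lam_pos
    field_simp
  rw [inner_zero_left]
  linarith

theorem exists_displacement [IsProbabilityMeasure P]
    (h : StoProblem P X F r φ ρ η lam xstar g) (hlb : LevelBoundedOn X φ)
    (hbound : BoundDD P X g ∨ BoundThree P X η r φ (φ xstar) lam g ∨
      BoundFour P X η r φ lam g) :
    ∃ C w, IsDisplacement P X r φ η lam xstar g C w := by
  rcases hbound with hb | hb | hb
  · exact h.displacement_of_boundDD hlb hb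
  · exact h.displacement_of_boundThree hlb hb
  · exact h.displacement_of_boundThree hlb (h.boundThree_of_boundFour hb)

theorem eventually_admissible (h : StoProblem P X F r φ ρ η lam xstar g)
    (hbound : BoundDD P X g ∨ BoundThree P X η r φ (φ xstar) lam g ∨
      BoundFour P X η r φ lam g) (hα : Tendsto α atTop (𝓝 0)) :
    ∀ᶠ k in atTop, AdmissibleStep P X ρ η r φ (φ xstar) lam g (α k) ∧ α k * η ≤ 1 / 2 := by
  have hη := h.eta_nonneg
  have hρ := h.rho_nonneg
  have hl := h.lam_pos
  have h1 : ∀ᶠ k in atTop, α k < 1 / (2 * (ρ + 2 * η + 1 / lam)) :=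
    hα.eventually_lt_const (by positivity)
  have h2 : ∀ᶠ k in atTop, 6 * η * α k < 1 := by
    have := hα.const_mul (6 * η)
    rw [mul_zero] at this
    exact this.eventually_lt_const one_pos
  filter_upwards [h1, h2] with k hk1 hk2
  refine ⟨?_, by linarith⟩
  rcases hbound with hb | hb
  · exact Or.inl ⟨hb, hk1⟩
  · exact Or.inr ⟨hb, hk2⟩

/-- Almost sure stationarity of the accumulation points. -/
theorem ae_tendsto_gradient [IsProbabilityMeasure P] [IsProbabilityMeasure μ]
    (h : StoProblem P X F r φ ρ η lam xstar g) (hlb : LevelBoundedOn X φ)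
    (hbound : BoundDD P X g ∨ BoundThree P X η r φ (φ xstar) lam g ∨
      BoundFour P X η r φ lam g) (hα : IsSigmaSequence α)
    (hr : IsStoSubGradRun μ P X r g α x0 ⊤ ℱ ξ x) (hx0 : x0 ∈ X) :
    ∀ᵐ ω ∂μ, Tendsto (fun k => ‖∇ (moreauEnv X φ lam) (x k ω)‖) atTop (𝓝 0) ∧
      ∀ z : Vec d, MapClusterPt z atTop (fun k => x k ω) → IsCriticalOn X (ρ + η) φ z := by
  obtain ⟨C, hC, hd⟩ := h.descent
  obtain ⟨C', w, hw⟩ := h.exists_displacement hlb hbound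
  have hα0 : Tendsto α atTop (𝓝 0) := by
    have h1 := hα.summable_sq.tendsto_atTop_zero.sqrt
    simpa only [Real.sqrt_sq (hα.pos _).le, Real.sqrt_zero] using h1
  obtain ⟨K, hK⟩ := eventually_atTop.1 (h.eventually_admissible hbound hα0)
  have had : ∀ k, K ≤ k → AdmissibleStep P X ρ η r φ (φ xstar) lam g (α k) :=
    fun k hk => (hK k hk).1
  have hstay : ∀ᵐ ω ∂μ, ∀ M₀ : ℕ, envGap X φ lam xstar (x K ω) ≤ M₀ →
      ∃ M : ℕ, ∀ n, ω ∈ staysBelow X φ lam xstar x K M₀ M n :=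
    ae_all_iff.2 fun M₀ => h.ae_exists_staysBelow hC hd hr hx0 hα.pos hα.summable_sq
      had M₀
  have hαη : ∀ k, K ≤ k → α k * η ≤ 1 / 2 := fun k hk => (hK k hk).2
  have hsum1 := ae_all_iff.2 fun M₀ : ℕ => ae_all_iff.2 fun M : ℕ =>
    h.ae_summable_gradient hC hd hr hx0 hα.pos hα.summable_sq had M₀ M
  have hsum2 := ae_all_iff.2 fun M₀ : ℕ => ae_all_iff.2 fun M : ℕ =>
    h.ae_summable_displacement_sq hw hr hx0 hα.pos hα.summable_sq hαη M₀ M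
  have hsum3 := ae_all_iff.2 fun M₀ : ℕ => ae_all_iff.2 fun M : ℕ => ae_all_iff.2 fun i : ℕ =>
    h.ae_summable_displacement hC hd hw hr hx0 hα.pos hα.summable_sq had hαη M₀ M
      (Nat.one_div_pos_of_nat (n := i) : (0 : ℝ) < 1 / ((i : ℝ) + 1))
  filter_upwards [hstay, hsum1, hsum2, hsum3] with ω h1 h2 h3 h4
  obtain ⟨M₀, hM₀⟩ := exists_nat_ge (envGap X φ lam xstar (x K ω))
  obtain ⟨M, hM⟩ := h1 M₀ hM₀
  have hlim := h.tendsto_norm_prox_sub hw hr hx0 hα hαη (fun n => (hM n).2 n le_rfl)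
    (h2 M₀ M hM) (h3 M₀ M hM) fun i => h4 M₀ M i hM
  refine ⟨?_, fun z hz => h.isCriticalOn_of_prox_eq ?_⟩
  · simp_rw [h.proxRegular.norm_gradient]
    simpa using hlim.const_mul (1 / lam)
  · have hcont : Continuous fun y => ‖proxMap X φ lam y - y‖ :=
      (h.proxRegular.continuous_prox.sub continuous_id).norm
    have h6 := hz.continuousAt_comp hcont.continuousAt
    have h7 : ‖proxMap X φ lam z - z‖ = 0 := by
      by_contra hne
      obtain ⟨U, V, hU, hV, hzU, h0V, hUV⟩ := t2_separation hne
      have hfr := h6.frequently (hU.mem_nhds hzU)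
      have hev : ∀ᶠ k in atTop, ‖proxMap X φ lam (x k ω) - x k ω‖ ∈ V :=
        hlim (hV.mem_nhds h0V)
      obtain ⟨k, hkU, hkV⟩ := (hfr.and_eventually hev).exists
      exact Set.disjoint_left.1 hUV hkU hkV
    exact sub_eq_zero.1 (norm_eq_zero.1 h7)

end StoProblem

/-! ### Expectations of weakly convex functions -/

theorem integrable_subgradient {d : ℕ} {S : Type*} [MeasurableSpace S]
    {P : Measure S} [IsProbabilityMeasure P] {X : Set (Vec d)} {r φ : Vec d → ℝ} {η φstar lam : ℝ}
    {g : ℕ → Vec d → S → Vec d} (hg_meas : ∀ k, Measurable (Function.uncurry (g k)))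
    (hbound : BoundDD P X g ∨ BoundThree P X η r φ φstar lam g ∨ BoundFour P X η r φ lam g)
    (k : ℕ) {x : Vec d} (hx : x ∈ X) : Integrable (g k x) P := by
  have hm : Measurable (g k x) := (hg_meas k).comp measurable_prodMk_left
  have hsq : ∀ v : Vec d, Integrable (fun s => ‖g k x s + v‖ ^ 2) P → Integrable (g k x) P := by
    intro v hv
    have h1 : MemLp (fun s => g k x s + v) 2 P :=
      (memLp_two_iff_integrable_sq_norm (hm.add_const v).aestronglyMeasurable).2 hv
    have h2 := (h1.integrable one_le_two).sub (integrable_const v)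
    exact h2.congr (ae_of_all _ fun s => by simp)
  rcases hbound with ⟨Lf, L, -, hL, -, hle⟩ | ⟨c₃, c₄, -, -, hb⟩ | ⟨c₅, c₆, -, -, hb⟩
  · exact (hL.integrable one_le_two).mono' hm.aestronglyMeasurable (ae_of_all _ (hle k x hx))
  · obtain ⟨v, -, hv, -⟩ := hb k x hx
    exact hsq v hv
  · obtain ⟨v, -, hv, -⟩ := hb k x hx
    exact hsq v hv

/-- The mean of subgradients of `f(·, ξ)` is a subgradient of the mean. -/
theorem integral_quadratic_support {d : ℕ} {S : Type*} [MeasurableSpace S]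
    {P : Measure S} {X : Set (Vec d)} {f : Vec d → S → ℝ}
    (hf_int : ∀ x ∈ X, Integrable (f x) P) {ρ : ℝ} {ρξ : S → ℝ} (hρξ_int : Integrable ρξ P)
    (hρ : (∫ s, ρξ s ∂P) ≤ ρ) {x y : Vec d} (hx : x ∈ X) (hy : y ∈ X) {v : S → Vec d}
    (hv : ∀ s, v s ∈ weakSubdiff X (ρξ s) (fun y => f y s) x) (hvi : Integrable v P) :
    (∫ s, f x s ∂P) + ⟪∫ s, v s ∂P, y - x⟫ - ρ / 2 * ‖y - x‖ ^ 2 ≤ ∫ s, f y s ∂P := by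
  have hI : ∫ s, ⟪v s, y - x⟫ ∂P = ⟪∫ s, v s ∂P, y - x⟫ := by
    simp_rw [real_inner_comm (y - x)]
    exact integral_inner hvi _
  have hi1 : Integrable (fun s => ⟪v s, y - x⟫) P := hvi.inner_const _
  have hi2 : Integrable (fun s => ρξ s * (‖y - x‖ ^ 2 / 2)) P := hρξ_int.mul_const _
  have h1 : ∫ s, f x s + ⟪v s, y - x⟫ - ρξ s * (‖y - x‖ ^ 2 / 2) ∂P ≤ ∫ s, f y s ∂P := by
    refine integral_mono (((hf_int x hx).add hi1).sub hi2) (hf_int y hy) fun s => ?_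
    have := mem_weakSubdiff_iff.1 (hv s) y hy
    simp only
    linarith
  have e : ∫ s, f x s + ⟪v s, y - x⟫ - ρξ s * (‖y - x‖ ^ 2 / 2) ∂P =
      (∫ s, f x s ∂P) + ⟪∫ s, v s ∂P, y - x⟫ - (∫ s, ρξ s ∂P) * (‖y - x‖ ^ 2 / 2) := by
    rw [integral_sub (by exact (hf_int x hx).add hi1) hi2, integral_add (hf_int x hx) hi1, hI,
      integral_mul_const]
  rw [e] at h1
  have h2 : (∫ s, ρξ s ∂P) * (‖y - x‖ ^ 2 / 2) ≤ ρ * (‖y - x‖ ^ 2 / 2) := by gcongr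
  linarith

/-! ### Convergence of the method -/

/-- The constant of the complexity bound, in terms of which `γ₄ = γ₅ = C` is an admissible choice.
The bound `e^t ≤ 1 + t e^t` makes room for the `1` that was added to the gap. -/
theorem gronwall_constant_le {C V S₂ a : ℝ} (hC : 0 < C) (hV : 0 ≤ V) (ha : S₂ ≤ a) (ha0 : 0 ≤ a) :
    C * ((V + 1) * Real.exp (C * S₂)) ≤ C + C * (V + C * a) * Real.exp (1 + C * a) := by
  have h1 : Real.exp (C * S₂) ≤ Real.exp (C * a) := by gcongr
  have h2 : Real.exp (C * a) ≤ Real.exp (1 + C * a) := Real.exp_le_exp.2 (by linarith)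
  have h3 : Real.exp (C * a) ≤ 1 + C * a * Real.exp (C * a) := by
    have h4 := Real.add_one_le_exp (-(C * a))
    have h5 := mul_le_mul_of_nonneg_right h4 (Real.exp_nonneg (C * a))
    rw [← Real.exp_add, neg_add_cancel, Real.exp_zero] at h5
    linarith
  calc C * ((V + 1) * Real.exp (C * S₂)) ≤ C * ((V + 1) * Real.exp (C * a)) := by gcongr
    _ = C * (V * Real.exp (C * a) + Real.exp (C * a)) := by ring
    _ ≤ C * (V * Real.exp (C * a) + (1 + C * a * Real.exp (C * a))) := by gcongr
    _ = C + C * (V + C * a) * Real.exp (C * a) := by ring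
    _ ≤ _ := by gcongr

theorem mainTheorem5 {d : ℕ} {S : Type*} [MeasurableSpace S]
    (P : Measure S) [IsProbabilityMeasure P]
    (X : Set (Vec d)) (hX_closed : IsClosed X) (hX_convex : Convex ℝ X)
    -- the data of the problem `min_{x ∈ X} φ(x) = E[f(x, ξ)] + r(x)`
    (f : Vec d → S → ℝ) (r φ : Vec d → ℝ) (hφ : φ = expectedObjective P f r)
    (hf_meas : Measurable (Function.uncurry f))
    (hf_int : ∀ x ∈ X, Integrable (f x) P)
    (hf_lsc : ∀ s, LowerSemicontinuousOn (fun x => f x s) X)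
    (hr_lsc : LowerSemicontinuousOn r X)
    -- weak convexity
    (η ρ : ℝ) (ρξ : S → ℝ) (hη : 0 ≤ η) (hr_wc : WeaklyConvexOn X η r)
    (hρξ_nonneg : ∀ s, 0 ≤ ρξ s) (hf_wc : ∀ s, WeaklyConvexOn X (ρξ s) (fun x => f x s))
    (hρξ_int : Integrable ρξ P) (hρ : (∫ s, ρξ s ∂P) ≤ ρ)
    -- an optimal solution; `φ* = φ xstar`
    (xstar : Vec d) (hxstar : xstar ∈ X) (hxstar_min : IsMinOn φ X xstar)
    -- the parameter of the Moreau envelope: `0 < λ < 1 / (ρ + 2η)`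
    (lam : ℝ) (hlam_pos : 0 < lam) (hlam : lam * (ρ + 2 * η) < 1)
    -- the subgradients `g k x ξ ∈ ∂f(x, ξ)` used in iteration `k`
    (g : ℕ → Vec d → S → Vec d) (hg_meas : ∀ k, Measurable (Function.uncurry (g k)))
    (hg : ∀ k, ∀ x ∈ X, ∀ s, g k x s ∈ weakSubdiff X (ρξ s) (fun y => f y s) x)
    (hbound : BoundDD P X g ∨ BoundThree P X η r φ (φ xstar) lam g ∨
      BoundFour P X η r φ lam g) :
    -- the gradient of the envelope exists
    Differentiable ℝ (moreauEnv X φ lam) ∧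
    -- (i)
    (LevelBoundedOn X φ →
      ∀ (Ω : Type*) [mΩ : MeasurableSpace Ω] (μ : Measure Ω) [IsProbabilityMeasure μ]
        (ℱ : Filtration ℕ mΩ) (ξ : ℕ → Ω → S) (x : ℕ → Ω → Vec d) (α : ℕ → ℝ),
        IsSigmaSequence α → ∀ x0 ∈ X, IsStoSubGradRun μ P X r g α x0 ⊤ ℱ ξ x →
        ∀ᵐ ω ∂μ,
          Tendsto (fun k => ‖∇ (moreauEnv X φ lam) (x k ω)‖) atTop (𝓝 0) ∧
          ∀ z : Vec d, MapClusterPt z atTop (fun k => x k ω) → IsCriticalOn X (ρ + η) φ z) ∧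
    -- (ii)
    (∃ γ₄ γ₅ : ℝ, 0 < γ₄ ∧ 0 < γ₅ ∧
      ∀ (Ω : Type*) [mΩ : MeasurableSpace Ω] (μ : Measure Ω) [IsProbabilityMeasure μ]
        (ℱ : Filtration ℕ mΩ) (ξ : ℕ → Ω → S) (x : ℕ → Ω → Vec d) (α : ℕ → ℝ) (abar γ₆ : ℝ),
        IsSigmaSequence α → (∑' k, α k ^ 2) ≤ abar →
        (∀ k, AdmissibleStep P X ρ η r φ (φ xstar) lam g (α k)) →
        ∀ x0 ∈ X, IsStoSubGradRun μ P X r g α x0 ⊤ ℱ ξ x →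
        γ₅ + γ₄ * (moreauEnv X φ lam x0 - φ xstar + γ₅ * abar) * Real.exp (1 + γ₄ * abar) ≤ γ₆ →
        ∀ T : ℕ,
          (∀ k ≤ T, Integrable (fun ω => ‖∇ (moreauEnv X φ lam) (x k ω)‖ ^ 2) μ) ∧
          (Finset.range (T + 1)).inf' Finset.nonempty_range_add_one
              (fun k => ∫ ω, ‖∇ (moreauEnv X φ lam) (x k ω)‖ ^ 2 ∂μ) ≤
            2 / (1 - lam * (ρ + 2 * η)) *
              ((moreauEnv X φ lam x0 - φ xstar + γ₆ * ∑ k ∈ Finset.range (T + 1), α k ^ 2) /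
                ∑ k ∈ Finset.range (T + 1), α k)) ∧
    -- (ii), constant stepsizes
    (∀ x0 ∈ X, ∀ Δ₄ : ℝ, 0 < Δ₄ → ∃ R₃ : ℝ, 0 ≤ R₃ ∧
      ∀ (T : ℕ) (Ω : Type*) [mΩ : MeasurableSpace Ω] (μ : Measure Ω) [IsProbabilityMeasure μ]
        (ℱ : Filtration ℕ mΩ) (ξ : ℕ → Ω → S) (x : ℕ → Ω → Vec d) (α : ℕ → ℝ),
        (∀ k ≤ T, α k = Δ₄ / √((T : ℝ) + 1)) →
        AdmissibleStep P X ρ η r φ (φ xstar) lam g (Δ₄ / √((T : ℝ) + 1)) →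
        IsStoSubGradRun μ P X r g α x0 ((T + 1 : ℕ) : ℕ∞) ℱ ξ x →
          (∀ k ≤ T, Integrable (fun ω => ‖∇ (moreauEnv X φ lam) (x k ω)‖ ^ 2) μ) ∧
          (Finset.range (T + 1)).inf' Finset.nonempty_range_add_one
              (fun k => ∫ ω, ‖∇ (moreauEnv X φ lam) (x k ω)‖ ^ 2 ∂μ) ≤
            R₃ / √((T : ℝ) + 1)) := by
  have hg_int : ∀ k, ∀ x ∈ X, Integrable (g k x) P := fun k x hx =>
    integrable_subgradient hg_meas hbound k hx
  have h : StoProblem P X (fun x => ∫ s, f x s ∂P) r φ ρ η lam xstar g :=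
    { eq_add := fun x => by rw [hφ]; rfl
      closed := hX_closed
      convex := hX_convex
      r_lsc := hr_lsc
      r_wc := hr_wc
      eta_nonneg := hη
      rho_nonneg := (integral_nonneg hρξ_nonneg).trans hρ
      lam_pos := hlam_pos
      lam_lt := hlam
      xstar_mem := hxstar
      isMinOn := hxstar_min
      g_meas := hg_meas
      g_int := hg_int
      support := fun k x hx y hy =>
        integral_quadratic_support hf_int hρξ_int hρ hx hy (hg k x hx) (hg_int k x hx) }
  obtain ⟨C, hC, hd⟩ := h.descent
  have hV0 := h.envGap_nonneg
  refine ⟨h.proxRegular.differentiable_moreauEnv, ?_, ⟨C, C, hC, hC, ?_⟩, ?_⟩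
  · intro hlb Ω mΩ μ _ ℱ ξ x α hα x0 hx0 hr
    exact h.ae_tendsto_gradient hlb hbound hα hr hx0
  · intro Ω mΩ μ _ ℱ ξ x α abar γ₆ hα habar had x0 hx0 hr hγ T
    have hS : ∑ k ∈ Finset.range (T + 1), α k ^ 2 ≤ abar :=
      (hα.summable_sq.sum_le_tsum _ fun _ _ => sq_nonneg _).trans habar
    have habar0 : 0 ≤ abar := (Finset.sum_nonneg fun _ _ => sq_nonneg _).trans hS
    exact h.min_expected_gradient_le hC hd hr hx0 le_top (fun k _ => hα.pos k) (fun k _ => had k)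
      ((gronwall_constant_le hC (hV0 x0) hS habar0).trans hγ)
  · intro x0 hx0 Δ hΔ
    set V := envGap X φ lam xstar x0 with hVdef
    set K := C * ((V + 1) * Real.exp (C * Δ ^ 2))
    have hV : 0 ≤ V := hV0 x0
    have hc : 0 < 1 - lam * (ρ + 2 * η) := by linarith
    refine ⟨2 / (1 - lam * (ρ + 2 * η)) * ((V + K * Δ ^ 2) / Δ), by positivity, ?_⟩
    intro T Ω mΩ μ _ ℱ ξ x α hα had hr
    have hT : (0 : ℝ) < √((T : ℝ) + 1) := Real.sqrt_pos.2 (by positivity)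
    have hT2 : √((T : ℝ) + 1) ^ 2 = (T : ℝ) + 1 := Real.sq_sqrt (by positivity)
    have hαr : ∀ k ∈ Finset.range (T + 1), α k = Δ / √((T : ℝ) + 1) := fun k hk =>
      hα k (Nat.lt_succ_iff.1 (Finset.mem_range.1 hk))
    have hS2 : ∑ k ∈ Finset.range (T + 1), α k ^ 2 = Δ ^ 2 := by
      rw [Finset.sum_congr rfl fun k hk => by rw [hαr k hk], Finset.sum_const, Finset.card_range,
        nsmul_eq_mul, div_pow, hT2]
      push_cast
      field_simp
    have hS1 : ∑ k ∈ Finset.range (T + 1), α k = Δ * √((T : ℝ) + 1) := by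
      rw [Finset.sum_congr rfl hαr, Finset.sum_const, Finset.card_range, nsmul_eq_mul]
      push_cast
      rw [mul_div_assoc', div_eq_iff hT.ne', mul_assoc, ← sq, hT2, mul_comm]
    have key := h.min_expected_gradient_le hC hd hr hx0 le_rfl
      (fun k hk => by rw [hα k hk]; positivity) (fun k hk => by rw [hα k hk]; exact had)
      (K := K) (by rw [hS2])
    refine ⟨key.1, key.2.trans (le_of_eq ?_)⟩
    rw [hS2, hS1, ← hVdef]
    field_simp
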